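/- **Setting.** Let $T>0$, let $\mathscr Q\subset\mathbb R^N$ be open (the range of the coordinates $q^i$), and let $K\subset\mathbb R^M$ be the closure of a bounded open set, with smooth boundary. For $n\ge 0$ a point of the $n$-th jet space $J^n(\mathscr Q|\mathbb R)$ is written $(t,q^i_{(\beta)})_{0\le\beta\le n}$; for a smooth curve $q:[0,T]\to\mathscr Q$ let $j^n_t(q)=(t,q^i_{(\beta)}(t))$ with $q^i_{(\beta)}=d^\beta q^i/dt^\beta$. A function on the jet space has *actual order* $r$ if it does not depend on $q^i_{(\beta)}$ for $\beta\ge r+1$. For a function $f=f(t,q^i_{(\beta)})$ of actual order $\le n-1$ put $\frac{df}{dt}=\frac{\partial f}{\partial t}+\sum_{j,\delta}\frac{\partial f}{\partial q^j_{(\delta)}}q^j_{(\delta+1)}$. Let $r\ge1$, $2r+1\le n$. A *defining triple* $(\mathscr K,L,C)$ consists of: * a smooth function $L=L(t,q^i_{(\beta)},u^a)$ on $J^n(\mathscr Q|\mathbb R)\times K$ of actual order $r$; * a smooth function $C$ on $J^n(\mathscr Q|\mathbb R)$ that vanishes on the jets at $t=0$ and has actual order at most $r-1$ (so that $dC/dt$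 has actual order at most $r$); * a set $\mathscr K$ of pairs $U=(u,\sigma)$, $u:[0,T]\to K$ a smooth curve and $\sigma$ a $(2r-1)$-jet at $t=0$, such that for each $U\in\mathscr K$ there is exactly one smooth curve $q:[0,T]\to\mathscr Q$ with $j^{2r-1}_{0}(q)=\sigma$ which solves the Euler–Lagrange equations $$\frac{\partial L}{\partial q^i}+\sum_{\beta=1}^{r}(-1)^\beta\Big(\frac{d}{dt}\Big)^{\beta}\Big(\frac{\partial L}{\partial q^i_{(\beta)}}\Big)=0,\qquad 1\le i\le N .$$ Here, and in every expression below that involves a Lagrangian with controls, $(d/dt)^\beta$ means the $\beta$-th derivative of the indicated function evaluated along $t\mapsto(j^n_t(q),u(t))$; that is, these are the Euler–Lagrange equations of the Lagrangian $L^{u(\cdot)}(t,q^i_{(\beta)})=L(t,q^i_{(\beta)},u(t))$. **The modified problem.** Introduce further real variables $\mathbf h^i_\beta,\mathbf h'^i_\beta,\mathbf h''^i_\beta$ ($1\le i\le N$, $0\le\beta\le r-1$) and $\lambda,\mu$, let $\widehat{\mathscr Q}=\mathscr Q\times\mathbb R^{3Nr+2}$, and let $\widehat L=\lambda(\mu_{(1)}+\widetilde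 L)+\frac{dC}{dt}$ with $$\widetilde L=L+\tfrac12\sum_{i,\beta}\Big((\mathbf h^i_{\beta(1)})^2-(\mathbf h'^i_{\beta(2)})^2-(\mathbf h''^i_{\beta(2)})^2\Big)+\tfrac12\sum_{i,\beta}\Big((\mathbf h^i_{\beta})^2+\big(\tfrac{\pi}{2T}\big)^4(\mathbf h'^i_{\beta})^2+\big(\tfrac{\pi}{2T}\big)^4(\mathbf h''^i_{\beta})^2\Big).$$ For a Lagrangian $\Lambda$ put $p^i_\beta(\Lambda)=\sum(-1)^\varepsilon\frac{d^\varepsilon}{dt^\varepsilon}\big(\frac{\partial\Lambda}{\partial q^i_{(\delta)}}\big)$, the sum being over $1\le\delta\le r$, $0\le\varepsilon\le\delta$ with $\delta-\varepsilon-1=\beta$. Let $\widehat r=\max\{r,2\}$. The set $\widehat{\mathscr K}$ consists of all pairs $\widehat U=(u,\widehat\sigma)$, $\widehat\sigma$ a $(2\widehat r-1)$-jet at $t=0$ in $\widehat{\mathscr Q}$ whose $q$-part $\sigma$ (truncated at order $2r-1$) satisfies $(u,\sigma)\in\mathscr K$, such that $\widehat\sigma$ is the initial jet of a smooth curve $\widehat\gamma^{(\widehat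 U)}=(q,\mathbf h,\mathbf h',\mathbf h'',\lambda,\mu):[0,T]\to\widehat{\mathscr Q}$ which solves the Euler–Lagrange equations of $\widehat L$ (for all variables, with control curve $u$), has $\lambda(0)=1$, $\mu(0)=0$, and satisfies for all $i,\beta$ $$\mathbf h^i_\beta(0)=q^i_{(\beta)}(0),\quad \mathbf h^i_{\beta(1)}(0)=-p^i_\beta(L)|_{t=0},\quad \mathbf h'^i_\beta(0)=\mathbf h'^i_{\beta(1)}(0)=\mathbf h''^i_\beta(0)=\mathbf h''^i_{\beta(1)}(0)=0,$$ $$\mathbf h'^i_{\beta(1)}(T)=q^i_{(\beta)}(T),\quad \mathbf h'^i_{\beta(2)}(T)=p^i_\beta\big(L+\tfrac{dC}{dt}\big)\big|_{t=T},\quad \mathbf h''^i_{\beta(1)}(T)=\mathbf h^i_\beta(T),\quad \mathbf h''^i_{\beta(2)}(T)=\mathbf h^i_{\beta(1)}(T).$$ **Theorem (Homotopy Formula – First Version).** Let $\widehat U(s)=(u(\cdot,s),\widehat\sigma(s))$, $s\in[0,1]$, be a smooth curve in $\widehat{\mathscr K}$ whose controlled curves form a smooth homotopy $\widehat F(t,s)=\widehat\gamma^{(\widehat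 U(s))}(t)$ on $[0,T]\times[0,1]$. Let $C_0$ and $C_1$ be the values of $C$ on the jets at $t=T$ of $\widehat\gamma^{(\widehat U(0))}$ and $\widehat\gamma^{(\widehat U(1))}$, let $\mathscr P_{j^n_t(\widehat\gamma)}(u)=-L(j^n_t(\widehat\gamma),u)$ for $u\in K$, let $\widehat\mu(t,s)$ be the $\mu$-component of $\widehat F(t,s)$, and let $Y^a=\partial u^a/\partial s$, $Y'^i_{\beta(0)}=\partial \mathbf h'^i_\beta/\partial s$, $Y''^i_{\beta(0)}=\partial\mathbf h''^i_\beta/\partial s$. Then $$C_1-C_0=-\int_0^T\!\!\int_0^1\Bigg(\sum_a Y^a\frac{\partial\mathscr P_{j^n_t(\widehat\gamma^{(\widehat U(s))})}}{\partial u^a}\Big|_{u(t,s)}-\frac{\partial^2\widehat\mu}{\partial t\,\partial s}\Big|_{(t,s)}-\sum_{\beta=0}^{r-1}\sum_{i=1}^N\frac{\partial^2}{\partial t\,\partial s}\int_0^s\Big(\mathbf h'^i_{\beta(3)}Y'^i_{\beta(0)}+\mathbf h''^i_{\beta(3)}Y''^i_{\beta(0)}\Big)\Big|_{(t,v)}dv\Bigg)ds\,dt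 .$$ -/

import Mathlib

open Set MeasureTheory
open scoped ContDiff

namespace ELMayer

noncomputable section

/-! ### Jets, total derivatives and Euler-Lagrange expressions -/

/-- The fibre coordinates `y^i_(k)`, `0 ≤ k ≤ n`, of the space of `n`-jets of curves in `ℝ^ι`
(the base coordinate `t` is kept as a separate argument everywhere). -/
abbrev Jet (ι : Type) (n : ℕ) : Type := Fin (n + 1) → ι → ℝ

/-- The jet coordinate `y^i_(k)`; it is only used for `k ≤ n`. -/
def Jet.coord {ι : Type} {n : ℕ} (x : Jet ι n) (k : ℕ) (i : ι) : ℝ :=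
  if h : k < n + 1 then x ⟨k, h⟩ i else 0

/-- The coordinate vector `∂/∂y^i_(k)` of the jet space (it is zero if `k > n`). -/
def coordVec {ι : Type} [DecidableEq ι] (n k : ℕ) (i : ι) : Jet ι n :=
  fun k' i' => if (k' : ℕ) = k ∧ i' = i then 1 else 0

/-- The partial derivative `∂f/∂y^i_(k)` of a function of the jet coordinates. -/
def jetPartial {ι : Type} [Fintype ι] [DecidableEq ι] {n : ℕ}
    (f : Jet ι n → ℝ) (k : ℕ) (i : ι) (x : Jet ι n) : ℝ :=
  fderiv ℝ f x (coordVec n k i)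

/-- The `n`-jet at time `t ∈ [0,T]` of a curve defined on `[0,T]`
(one-sided derivatives at the end points). -/
def jet {ι : Type} [Fintype ι] (T : ℝ) (n : ℕ) (y : ℝ → ι → ℝ) (t : ℝ) : Jet ι n :=
  fun k => iteratedDerivWithin k y (Icc 0 T) t

/-- The total derivative `df/dt = ∂f/∂t + ∑_{k < n} ∑_j (∂f/∂y^j_(k)) y^j_(k+1)`
of a function of actual order at most `n - 1` on the `n`-th jet space. -/
def totalDeriv {ι : Type} [Fintype ι] [DecidableEq ι] {n : ℕ}
    (f : ℝ → Jet ι n → ℝ) (t : ℝ) (x : Jet ι n) : ℝ :=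
  deriv (fun τ => f τ x) t
    + ∑ k ∈ Finset.range n, ∑ j, jetPartial (f t) k j x * x.coord (k + 1) j

/-- The function `t ↦ (∂L/∂y^i_(k)) (j^n_t(y), u(t))`. -/
def partialAlong {ι : Type} [Fintype ι] [DecidableEq ι] {M n : ℕ} (T : ℝ)
    (L : ℝ → Jet ι n → (Fin M → ℝ) → ℝ) (u : ℝ → Fin M → ℝ) (y : ℝ → ι → ℝ)
    (k : ℕ) (i : ι) (t : ℝ) : ℝ :=
  jetPartial (fun x => L t x (u t)) k i (jet T n y t)

/-- The Euler-Lagrange expression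
`E_i = ∂L/∂y^i + ∑_{1 ≤ β ≤ r} (-1)^β (d/dt)^β (∂L/∂y^i_(β))` of the order `r` Lagrangian
`L^{u(·)}(t, y, …, y_(r)) = L(t, y, …, y_(r), u(t))`, evaluated along the curve `y`. -/
def eulerLagrange {ι : Type} [Fintype ι] [DecidableEq ι] {M n : ℕ} (T : ℝ) (r : ℕ)
    (L : ℝ → Jet ι n → (Fin M → ℝ) → ℝ) (u : ℝ → Fin M → ℝ) (y : ℝ → ι → ℝ)
    (i : ι) (t : ℝ) : ℝ :=
  ∑ β ∈ Finset.range (r + 1),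
    (-1) ^ β * iteratedDerivWithin β (partialAlong T L u y β i) (Icc 0 T) t

/-- The sum of `(-1)^ε (d/dt)^ε (∂L/∂y^i_(δ))` over all `1 ≤ δ ≤ r`, `0 ≤ ε ≤ δ` with
`δ - ε - 1 = β`, evaluated along `(y, u)` (the index `δ` is `β + ε + 1`). -/
def momentum {ι : Type} [Fintype ι] [DecidableEq ι] {M n : ℕ} (T : ℝ) (r : ℕ)
    (L : ℝ → Jet ι n → (Fin M → ℝ) → ℝ) (u : ℝ → Fin M → ℝ) (y : ℝ → ι → ℝ)
    (i : ι) (β : ℕ) (t : ℝ) : ℝ :=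
  ∑ ε ∈ Finset.range (r - β),
    (-1) ^ ε * iteratedDerivWithin ε (partialAlong T L u y (β + ε + 1) i) (Icc 0 T) t

/-- `y` is a smooth curve `[0,T] → Ω` which solves the Euler-Lagrange equations of `L^{u(·)}`. -/
structure IsELSolution {ι : Type} [Fintype ι] [DecidableEq ι] {M n : ℕ} (T : ℝ) (r : ℕ)
    (Ω : Set (ι → ℝ)) (L : ℝ → Jet ι n → (Fin M → ℝ) → ℝ) (u : ℝ → Fin M → ℝ)
    (y : ℝ → ι → ℝ) : Prop where
  smooth : ContDiffOn ℝ ∞ y (Icc 0 T)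
  mapsTo : MapsTo y (Icc 0 T) Ω
  eq_zero : ∀ i, ∀ t ∈ Icc 0 T, eulerLagrange T r L u y i t = 0

/-! ### Defining triples -/

/-- `K` is the closure of a bounded open set and has a smooth boundary: near each boundary
point it is a sublevel set of a smooth function with non-zero differential. -/
structure IsControlSpace {M : ℕ} (K : Set (Fin M → ℝ)) : Prop where
  closure_open : ∃ U : Set (Fin M → ℝ), IsOpen U ∧ Bornology.IsBounded U ∧ K = closure U
  smooth_boundary : ∀ x ∈ frontier K, ∃ (V : Set (Fin M → ℝ)) (g : (Fin M → ℝ) → ℝ),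
    IsOpen V ∧ x ∈ V ∧ ContDiffOn ℝ ∞ g V ∧ fderiv ℝ g x ≠ 0 ∧ K ∩ V = {z ∈ V | g z ≤ 0}

/-- A defining triple `(𝒦, L, C)` for a system with `N` coordinates and `M` controls. -/
structure DefiningTriple (N M : ℕ) where
  /-- the final time -/
  T : ℝ
  T_pos : 0 < T
  /-- the state space, as the range of the coordinates `(q^i)` -/
  Q : Set (Fin N → ℝ)
  isOpen_Q : IsOpen Q
  /-- the set of control values -/
  K : Set (Fin M → ℝ)
  isControlSpace : IsControlSpace K
  /-- the actual order of the Lagrangian -/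
  r : ℕ
  one_le_r : 1 ≤ r
  /-- the order of the jet space on which everything is defined -/
  n : ℕ
  order_le : 2 * r + 1 ≤ n
  /-- the Lagrangian with controls -/
  L : ℝ → Jet (Fin N) n → (Fin M → ℝ) → ℝ
  L_smooth : ContDiffOn ℝ ∞
    (fun z : ℝ × Jet (Fin N) n × (Fin M → ℝ) => L z.1 z.2.1 z.2.2) {z | z.2.1 0 ∈ Q ∧ z.2.2 ∈ K}
  L_order : ∀ t, ∀ x x' : Jet (Fin N) n, ∀ w ∈ K, x 0 ∈ Q →
    (∀ k : Fin (n + 1), (k : ℕ) ≤ r → x k = x' k) → L t x w = L t x' w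
  /-- the (extended) cost function -/
  C : ℝ → Jet (Fin N) n → ℝ
  C_smooth : ContDiffOn ℝ ∞ (fun z : ℝ × Jet (Fin N) n => C z.1 z.2) {z | z.2 0 ∈ Q}
  /-- the actual order of `C` is at most `r - 1`, i.e. that of `dC/dt` is at most `r` -/
  C_order : ∀ t, ∀ x x' : Jet (Fin N) n, x 0 ∈ Q →
    (∀ k : Fin (n + 1), (k : ℕ) ≤ r - 1 → x k = x' k) → C t x = C t x'
  C_zero : ∀ x : Jet (Fin N) n, x 0 ∈ Q → C 0 x = 0
  /-- the set `𝒦` of pairs `U = (u, σ)`: a control curve on `[0,T]` and an initial jet of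
  order `2r - 1`; only the values of `u` on `[0,T]` matter -/
  controls : Set ((ℝ → Fin M → ℝ) × Jet (Fin N) (2 * r - 1))
  controls_smooth : ∀ U ∈ controls, ContDiffOn ℝ ∞ U.1 (Icc 0 T) ∧ MapsTo U.1 (Icc 0 T) K
  /-- each `U ∈ 𝒦` determines exactly one curve on `[0,T]` -/
  wellPosed : ∀ U ∈ controls, ∃ q : ℝ → Fin N → ℝ,
    (IsELSolution T r Q L U.1 q ∧ jet T (2 * r - 1) q 0 = U.2) ∧
    ∀ q' : ℝ → Fin N → ℝ, IsELSolution T r Q L U.1 q' ∧ jet T (2 * r - 1) q' 0 = U.2 →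
      EqOn q' q (Icc 0 T)

/-! ### The modified problem with the auxiliary variables -/

/-- Labels of the coordinates `q^i`, `h^i_β`, `h'^i_β`, `h''^i_β`, `λ`, `μ`
(`1 ≤ i ≤ N`, `0 ≤ β ≤ r - 1`) of the extended state space. -/
abbrev HatIdx (N r : ℕ) : Type := Fin N ⊕ (Fin 3 × Fin N × Fin r) ⊕ Fin 2

/-- the label of `q^i` -/
abbrev iq {N r : ℕ} (i : Fin N) : HatIdx N r := Sum.inl i

/-- the label of `h^i_β` -/
abbrev ih {N r : ℕ} (i : Fin N) (β : Fin r) : HatIdx N r := Sum.inr (Sum.inl (0, i, β))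

/-- the label of `h'^i_β` -/
abbrev ih1 {N r : ℕ} (i : Fin N) (β : Fin r) : HatIdx N r := Sum.inr (Sum.inl (1, i, β))

/-- the label of `h''^i_β` -/
abbrev ih2 {N r : ℕ} (i : Fin N) (β : Fin r) : HatIdx N r := Sum.inr (Sum.inl (2, i, β))

/-- the label of `λ` -/
abbrev ilam {N r : ℕ} : HatIdx N r := Sum.inr (Sum.inr 0)

/-- the label of `μ` -/
abbrev imu {N r : ℕ} : HatIdx N r := Sum.inr (Sum.inr 1)

/-- The `q`-part of a jet in the extended space. -/
def qJet {N r n : ℕ} (x : Jet (HatIdx N r) n) : Jet (Fin N) n := fun k i => x k (iq i)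

/-- The `q`-part of a curve in the extended space. -/
def qCurve {N r : ℕ} (y : ℝ → HatIdx N r → ℝ) : ℝ → Fin N → ℝ := fun t i => y t (iq i)

namespace DefiningTriple

variable {N M : ℕ} (P : DefiningTriple N M)

/-- The extended state space `Q × ℝ^{3Nr} × ℝ²`. -/
def hatQ : Set (HatIdx N P.r → ℝ) := {y | (fun i => y (iq i)) ∈ P.Q}

/-- The actual order `max {r, 2}` of the modified Lagrangian. -/
def hatr : ℕ := max P.r 2

/-- The Lagrangian
`L + ½ ∑ (h_(1)² - h'_(2)² - h''_(2)²) + ½ ∑ (h² + (π/2T)⁴ h'² + (π/2T)⁴ h''²)`,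
the sums being over `1 ≤ i ≤ N` and `0 ≤ β ≤ r - 1`. -/
def tildeL (t : ℝ) (x : Jet (HatIdx N P.r) P.n) (w : Fin M → ℝ) : ℝ :=
  P.L t (qJet x) w
    + 1 / 2 * ∑ i : Fin N, ∑ β : Fin P.r,
        ((x.coord 1 (ih i β)) ^ 2 - (x.coord 2 (ih1 i β)) ^ 2 - (x.coord 2 (ih2 i β)) ^ 2)
    + 1 / 2 * ∑ i : Fin N, ∑ β : Fin P.r,
        ((x.coord 0 (ih i β)) ^ 2 + (Real.pi / (2 * P.T)) ^ 4 * (x.coord 0 (ih1 i β)) ^ 2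
          + (Real.pi / (2 * P.T)) ^ 4 * (x.coord 0 (ih2 i β)) ^ 2)

/-- The modified Lagrangian `λ (μ_(1) + tildeL) + dC/dt`. -/
def hatL (t : ℝ) (x : Jet (HatIdx N P.r) P.n) (w : Fin M → ℝ) : ℝ :=
  x.coord 0 ilam * (x.coord 1 imu + P.tildeL t x w) + totalDeriv P.C t (qJet x)

/-- The Lagrangian `L + dC/dt`. -/
def LdC (t : ℝ) (x : Jet (Fin N) P.n) (w : Fin M → ℝ) : ℝ :=
  P.L t x w + totalDeriv P.C t x

/-- The `q`-part of an initial datum of order `2 max {r, 2} - 1`, truncated at order `2r - 1`. -/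
def qDatum (σ : Jet (HatIdx N P.r) (2 * P.hatr - 1)) : Jet (Fin N) (2 * P.r - 1) :=
  fun k i => σ.coord k (iq i)

/-- The derivative of order `k` at time `t` of a component of a curve in the extended space. -/
def comp (y : ℝ → HatIdx N P.r → ℝ) (j : HatIdx N P.r) (k : ℕ) (t : ℝ) : ℝ :=
  iteratedDerivWithin k (fun τ => y τ j) (Icc 0 P.T) t

/-- `y = (q, h, h', h'', λ, μ)` is the controlled curve of the modified problem which is
determined by the pair `(u, σ)`: the `q`-part of `(u, σ)` is in `𝒦`, `y` solves the
Euler-Lagrange equations of the modified Lagrangian with initial datum `σ`, and it satisfies the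
conditions which are imposed on `h`, `h'`, `h''`, `λ`, `μ`. -/
structure IsHatControlled (u : ℝ → Fin M → ℝ) (σ : Jet (HatIdx N P.r) (2 * P.hatr - 1))
    (y : ℝ → HatIdx N P.r → ℝ) : Prop where
  q_mem : (u, P.qDatum σ) ∈ P.controls
  solution : IsELSolution P.T P.hatr P.hatQ P.hatL u y
  initial : jet P.T (2 * P.hatr - 1) y 0 = σ
  h_zero : ∀ i β, P.comp y (ih i β) 0 0 = P.comp y (iq i) β 0
  h_zero_deriv : ∀ i β,
    P.comp y (ih i β) 1 0 = - momentum P.T P.r P.L u (qCurve y) i β 0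
  h1_zero : ∀ i β, P.comp y (ih1 i β) 0 0 = 0
  h1_zero_deriv : ∀ i β, P.comp y (ih1 i β) 1 0 = 0
  h1_T_deriv : ∀ i β, P.comp y (ih1 i β) 1 P.T = P.comp y (iq i) β P.T
  h1_T_deriv2 : ∀ i β,
    P.comp y (ih1 i β) 2 P.T = momentum P.T P.r P.LdC u (qCurve y) i β P.T
  h2_zero : ∀ i β, P.comp y (ih2 i β) 0 0 = 0
  h2_zero_deriv : ∀ i β, P.comp y (ih2 i β) 1 0 = 0
  h2_T_deriv : ∀ i β, P.comp y (ih2 i β) 1 P.T = P.comp y (ih i β) 0 P.T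
  h2_T_deriv2 : ∀ i β, P.comp y (ih2 i β) 2 P.T = P.comp y (ih i β) 1 P.T
  lam_zero : P.comp y ilam 0 0 = 1
  mu_zero : P.comp y imu 0 0 = 0

/-- The set `𝒦̂` of the modified problem: all pairs `(u, σ)` that determine a controlled curve. -/
def hatControls : Set ((ℝ → Fin M → ℝ) × Jet (HatIdx N P.r) (2 * P.hatr - 1)) :=
  {U | ∃ y, P.IsHatControlled U.1 U.2 y}

/-- `F` is the controlled variation determined by the smooth curve
`s ↦ (u(·,s), σ(s))`, `s ∈ [0,1]`, in `𝒦̂`. -/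
structure IsHatVariation (u : ℝ → ℝ → Fin M → ℝ)
    (σ : ℝ → Jet (HatIdx N P.r) (2 * P.hatr - 1))
    (F : ℝ → ℝ → HatIdx N P.r → ℝ) : Prop where
  mem : ∀ s ∈ Icc (0 : ℝ) 1, ((fun t => u t s), σ s) ∈ P.hatControls
  u_smooth : ContDiffOn ℝ ∞ (fun p : ℝ × ℝ => u p.1 p.2) (Icc 0 P.T ×ˢ Icc 0 1)
  σ_smooth : ContDiffOn ℝ ∞ σ (Icc 0 1)
  controlled : ∀ s ∈ Icc (0 : ℝ) 1,
    P.IsHatControlled (fun t => u t s) (σ s) (fun t => F t s)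
  F_smooth : ContDiffOn ℝ ∞ (fun p : ℝ × ℝ => F p.1 p.2) (Icc 0 P.T ×ˢ Icc 0 1)

/-- The terminal cost of a curve of the modified problem. -/
def terminalCost (y : ℝ → HatIdx N P.r → ℝ) : ℝ :=
  P.C P.T (qJet (jet P.T P.n y P.T))

/-- The function `𝒫 = -L` of the control value, at the `n`-jet `x` at time `t`. -/
def pontryagin (t : ℝ) (x : Jet (HatIdx N P.r) P.n) (w : Fin M → ℝ) : ℝ :=
  - P.L t (qJet x) w

/-- The partial derivative `∂𝒫/∂u^a` on `K`. -/
def pontryaginPartial (t : ℝ) (x : Jet (HatIdx N P.r) P.n) (a : Fin M) (w : Fin M → ℝ) : ℝ :=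
  fderivWithin ℝ (P.pontryagin t x) P.K w (Pi.single a 1)

/-- The `u^a`-component `∂u^a/∂s` of the variation field at `(t, s)`. -/
def Yu (u : ℝ → ℝ → Fin M → ℝ) (a : Fin M) (t s : ℝ) : ℝ :=
  derivWithin (fun s' => u t s' a) (Icc 0 1) s

/-- The component `∂F^j/∂s` of the variation field at `(t, s)` along an order-zero coordinate. -/
def Y (F : ℝ → ℝ → HatIdx N P.r → ℝ) (j : HatIdx N P.r) (t s : ℝ) : ℝ :=
  derivWithin (fun s' => F t s' j) (Icc 0 1) s

/-- The mixed derivative `∂²f/∂t∂s` on `[0,T] × [0,1]`. -/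
def mixedDeriv (f : ℝ → ℝ → ℝ) (t s : ℝ) : ℝ :=
  derivWithin (fun t' => derivWithin (fun s' => f t' s') (Icc 0 1) s) (Icc 0 P.T) t

/-- The function `h'^i_{β(3)} Y'^i_{β(0)} + h''^i_{β(3)} Y''^i_{β(0)}` at `(t, v)`. -/
def correction (F : ℝ → ℝ → HatIdx N P.r → ℝ) (i : Fin N) (β : Fin P.r) (t v : ℝ) : ℝ :=
  P.comp (fun τ => F τ v) (ih1 i β) 3 t * P.Y F (ih1 i β) t v
    + P.comp (fun τ => F τ v) (ih2 i β) 3 t * P.Y F (ih2 i β) t v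

end DefiningTriple

end

end ELMayer

/-! The integrand of the homotopy formula is an exact `t`-derivative `∂B/∂t`, where the boundary
term `B` (`boundaryTerm`) vanishes at `t = 0` and equals `-dC/ds` at `t = T`. Fubini and the
fundamental theorem of calculus in `t` and then in `s` give the result.

Exactness comes from the Euler-Lagrange equations of the modified Lagrangian. The equation for `μ`
makes `λ` constant, hence `λ = 1`; the equation for `λ` then reads `μ_(1) + tildeL = 0`. This
identity holds for all `s`, so it can be differentiated in `s` (`integrand_eq`). The `L`-part of
`∂_s tildeL` is handled by the first variation formula `ds_lagrangian`: a control term, the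
Euler-Lagrange expression times `∂_s q`, and the `t`-derivative of `∑ p_β ∂_s q_(β)`. The
Euler-Lagrange expression of `L` vanishes because `dC/dt` is a null Lagrangian (`altSum_total_zero`,
`eulerLagrange_L`). For the quadratic part, `h_(2) = h` and `h'_(4) = κ h'`, `h''_(4) = κ h''` with
`κ = (π/2T)⁴`, so it too is a `t`-derivative: that of `auxTerm` plus that of `correction`, and the
latter is what the formula subtracts explicitly.

The auxiliary variables exist to adjust the end values of `B`. At `t = 0` the data of `h` cancel `∑
p_β ∂_s q_(β)` (`boundaryTerm_zero`). At `t = T` the variable `h''` cancels the term left by `h`,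
and `h'` subtracts the momenta of `L + dC/dt`, which exceed those of `L` by `∂C/∂q_(β)`
(`momentum_LdC`); only `-dC/ds` survives (`boundaryTerm_T`). -/

namespace ELMayer

noncomputable section

/-! ### Smooth functions on the rectangle `[0,T] × [0,1]` -/

/-- `(t, s) ↦ f t s` is smooth on `[0,T] × [0,1]`. -/
def SmoothOnRect {E : Type*} [NormedAddCommGroup E] [NormedSpace ℝ E] (T : ℝ)
    (f : ℝ → ℝ → E) : Prop :=
  ContDiffOn ℝ ∞ (fun p : ℝ × ℝ => f p.1 p.2) (Icc 0 T ×ˢ Icc 0 1)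

/-- The partial derivative `∂f/∂t` on `[0,T] × [0,1]`. -/
def dt {E : Type*} [NormedAddCommGroup E] [NormedSpace ℝ E] (T : ℝ)
    (f : ℝ → ℝ → E) (t s : ℝ) : E :=
  derivWithin (fun τ => f τ s) (Icc 0 T) t

/-- The partial derivative `∂f/∂s` on `[0,T] × [0,1]`. -/
def ds {E : Type*} [NormedAddCommGroup E] [NormedSpace ℝ E]
    (f : ℝ → ℝ → E) (t s : ℝ) : E :=
  derivWithin (fun v => f t v) (Icc 0 1) s

/-- The iterated partial derivative `∂^k f/∂t^k` on `[0,T] × [0,1]`. -/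
def dtIter {E : Type*} [NormedAddCommGroup E] [NormedSpace ℝ E] (T : ℝ) (k : ℕ)
    (f : ℝ → ℝ → E) (t s : ℝ) : E :=
  iteratedDerivWithin k (fun τ => f τ s) (Icc 0 T) t

section Rect

variable {E : Type*} [NormedAddCommGroup E] [NormedSpace ℝ E] {T : ℝ} {f g : ℝ → ℝ → E}
  {t s : ℝ}

lemma uniqueDiffOn_rect (hT : 0 < T) : UniqueDiffOn ℝ (Icc 0 T ×ˢ Icc (0 : ℝ) 1) :=
  (uniqueDiffOn_Icc hT).prod (uniqueDiffOn_Icc one_pos)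

/-- Symmetry of second derivatives within a set is obtained by approximation from interior points;
this supplies that condition at the edges and corners. -/
lemma mem_closure_interior_rect (hT : 0 < T) (ht : t ∈ Icc 0 T) (hs : s ∈ Icc (0 : ℝ) 1) :
    (t, s) ∈ closure (interior (Icc 0 T ×ˢ Icc (0 : ℝ) 1)) := by
  rw [interior_prod_eq, interior_Icc, interior_Icc, closure_prod_eq, closure_Ioo hT.ne,
    closure_Ioo zero_ne_one]
  exact ⟨ht, hs⟩

lemma SmoothOnRect.hasFDerivWithinAt (hf : SmoothOnRect T f) (ht : t ∈ Icc 0 T)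
    (hs : s ∈ Icc (0 : ℝ) 1) :
    HasFDerivWithinAt (fun p : ℝ × ℝ => f p.1 p.2)
      (fderivWithin ℝ (fun p : ℝ × ℝ => f p.1 p.2) (Icc 0 T ×ˢ Icc 0 1) (t, s))
      (Icc 0 T ×ˢ Icc 0 1) (t, s) :=
  ((hf.differentiableOn (by simp)) (t, s) ⟨ht, hs⟩).hasFDerivWithinAt

lemma SmoothOnRect.hasDerivWithinAt_fderivWithin_fst (hf : SmoothOnRect T f) (ht : t ∈ Icc 0 T)
    (hs : s ∈ Icc (0 : ℝ) 1) :
    HasDerivWithinAt (fun τ => f τ s)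
      (fderivWithin ℝ (fun p : ℝ × ℝ => f p.1 p.2) (Icc 0 T ×ˢ Icc 0 1) (t, s) (1, 0))
      (Icc 0 T) t := by
  have h : HasDerivWithinAt (fun τ : ℝ => (τ, s)) (1, 0) (Icc 0 T) t :=
    (hasDerivWithinAt_id t _).prodMk (hasDerivWithinAt_const t _ s)
  have hm : MapsTo (fun τ : ℝ => (τ, s)) (Icc 0 T) (Icc 0 T ×ˢ Icc 0 1) := fun τ hτ => ⟨hτ, hs⟩
  exact (hf.hasFDerivWithinAt ht hs).comp_hasDerivWithinAt t h hm

lemma SmoothOnRect.hasDerivWithinAt_fderivWithin_snd (hf : SmoothOnRect T f) (ht : t ∈ Icc 0 T)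
    (hs : s ∈ Icc (0 : ℝ) 1) :
    HasDerivWithinAt (fun v => f t v)
      (fderivWithin ℝ (fun p : ℝ × ℝ => f p.1 p.2) (Icc 0 T ×ˢ Icc 0 1) (t, s) (0, 1))
      (Icc 0 1) s := by
  have h : HasDerivWithinAt (fun v : ℝ => (t, v)) (0, 1) (Icc 0 1) s :=
    (hasDerivWithinAt_const s _ t).prodMk (hasDerivWithinAt_id s _)
  exact (hf.hasFDerivWithinAt ht hs).comp_hasDerivWithinAt s h (fun v hv => ⟨ht, hv⟩)

/-- Reading the one-sided partials off the Fréchet derivative lets smoothness and the symmetry of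
mixed partials be inherited from `fderivWithin` on the rectangle. -/
lemma SmoothOnRect.dt_eq (hT : 0 < T) (hf : SmoothOnRect T f) (ht : t ∈ Icc 0 T)
    (hs : s ∈ Icc (0 : ℝ) 1) :
    dt T f t s
      = fderivWithin ℝ (fun p : ℝ × ℝ => f p.1 p.2) (Icc 0 T ×ˢ Icc 0 1) (t, s) (1, 0) :=
  (hf.hasDerivWithinAt_fderivWithin_fst ht hs).derivWithin (uniqueDiffOn_Icc hT t ht)

lemma SmoothOnRect.ds_eq (hf : SmoothOnRect T f) (ht : t ∈ Icc 0 T)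
    (hs : s ∈ Icc (0 : ℝ) 1) :
    ds f t s
      = fderivWithin ℝ (fun p : ℝ × ℝ => f p.1 p.2) (Icc 0 T ×ˢ Icc 0 1) (t, s) (0, 1) :=
  (hf.hasDerivWithinAt_fderivWithin_snd ht hs).derivWithin (uniqueDiffOn_Icc one_pos s hs)

lemma SmoothOnRect.hasDerivWithinAt_dt (hT : 0 < T) (hf : SmoothOnRect T f) (ht : t ∈ Icc 0 T)
    (hs : s ∈ Icc (0 : ℝ) 1) :
    HasDerivWithinAt (fun τ => f τ s) (dt T f t s) (Icc 0 T) t := by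
  rw [hf.dt_eq hT ht hs]; exact hf.hasDerivWithinAt_fderivWithin_fst ht hs

lemma SmoothOnRect.hasDerivWithinAt_ds (hf : SmoothOnRect T f) (ht : t ∈ Icc 0 T)
    (hs : s ∈ Icc (0 : ℝ) 1) :
    HasDerivWithinAt (fun v => f t v) (ds f t s) (Icc 0 1) s := by
  rw [hf.ds_eq ht hs]; exact hf.hasDerivWithinAt_fderivWithin_snd ht hs

lemma SmoothOnRect.congr (hf : SmoothOnRect T f)
    (h : ∀ t ∈ Icc 0 T, ∀ s ∈ Icc (0 : ℝ) 1, g t s = f t s) : SmoothOnRect T g :=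
  ContDiffOn.congr hf (fun p hp => h p.1 hp.1 p.2 hp.2)

lemma SmoothOnRect.fderivWithin_apply (hT : 0 < T) (hf : SmoothOnRect T f) (w : ℝ × ℝ) :
    ContDiffOn ℝ ∞ (fun p => fderivWithin ℝ (fun p : ℝ × ℝ => f p.1 p.2)
      (Icc 0 T ×ˢ Icc 0 1) p w) (Icc 0 T ×ˢ Icc 0 1) :=
  (ContDiffOn.fderivWithin hf (uniqueDiffOn_rect hT) (by simp)).clm_apply contDiffOn_const

lemma SmoothOnRect.dt (hT : 0 < T) (hf : SmoothOnRect T f) : SmoothOnRect T (dt T f) :=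
  (hf.fderivWithin_apply hT (1, 0)).congr fun _ hp => hf.dt_eq hT hp.1 hp.2

lemma SmoothOnRect.ds (hT : 0 < T) (hf : SmoothOnRect T f) : SmoothOnRect T (ds f) :=
  (hf.fderivWithin_apply hT (0, 1)).congr fun _ hp => hf.ds_eq hp.1 hp.2

lemma dt_congr (ht : t ∈ Icc 0 T) (hs : s ∈ Icc (0 : ℝ) 1)
    (h : ∀ t ∈ Icc 0 T, ∀ s ∈ Icc (0 : ℝ) 1, f t s = g t s) : dt T f t s = dt T g t s :=
  derivWithin_congr (fun τ hτ => h τ hτ s hs) (h t ht s hs)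

/-- Mixed partial derivatives commute on the rectangle. -/
lemma SmoothOnRect.ds_dt (hT : 0 < T) (hf : SmoothOnRect T f) (ht : t ∈ Icc 0 T)
    (hs : s ∈ Icc (0 : ℝ) 1) :
    ELMayer.ds (ELMayer.dt T f) t s = ELMayer.dt T (ELMayer.ds f) t s := by
  set R : Set (ℝ × ℝ) := Icc 0 T ×ˢ Icc 0 1 with hR
  have hp : (t, s) ∈ R := ⟨ht, hs⟩
  have hd : DifferentiableWithinAt ℝ (fderivWithin ℝ (fun p : ℝ × ℝ => f p.1 p.2) R) R (t, s) :=
    (ContDiffOn.fderivWithin (m := 1) hf (uniqueDiffOn_rect hT) (by norm_cast)).differentiableOn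
      one_ne_zero _ hp
  -- A second partial derivative is the second Fréchet derivative on two fixed vectors, so
  -- commutation reduces to its symmetry.
  have key : ∀ w w' : ℝ × ℝ,
      fderivWithin ℝ (fun p => fderivWithin ℝ (fun p : ℝ × ℝ => f p.1 p.2) R p w) R (t, s) w'
        = fderivWithin ℝ (fderivWithin ℝ (fun p : ℝ × ℝ => f p.1 p.2) R) R (t, s) w' w := by
    intro w w'
    have := (hd.hasFDerivWithinAt.clm_apply (hasFDerivWithinAt_const w (t, s) R)).fderivWithin
      (uniqueDiffOn_rect hT _ hp)
    rw [this]; simp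
  have hsymm : IsSymmSndFDerivWithinAt ℝ (fun p : ℝ × ℝ => f p.1 p.2) R (t, s) :=
    ContDiffWithinAt.isSymmSndFDerivWithinAt (n := ∞) (ContDiffOn.contDiffWithinAt hf hp)
      (by simpa using (by norm_cast : (2 : ℕ∞ω) ≤ ∞)) (uniqueDiffOn_rect hT)
      (mem_closure_interior_rect hT ht hs) hp
  rw [(hf.dt hT).ds_eq ht hs, (hf.ds hT).dt_eq hT ht hs,
    fderivWithin_congr (f := fun p => fderivWithin ℝ (fun p : ℝ × ℝ => f p.1 p.2) R p (1, 0))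
      (fun p hp => hf.dt_eq hT hp.1 hp.2) (hf.dt_eq hT ht hs),
    fderivWithin_congr (f := fun p => fderivWithin ℝ (fun p : ℝ × ℝ => f p.1 p.2) R p (0, 1))
      (fun p hp => hf.ds_eq hp.1 hp.2) (hf.ds_eq ht hs), key, key]
  exact hsymm _ _

lemma dtIter_succ (k : ℕ) (f : ℝ → ℝ → E) : dtIter T (k + 1) f = dt T (dtIter T k f) := by
  funext t s
  exact congrFun (iteratedDerivWithin_succ (f := fun τ => f τ s)) t

lemma dtIter_zero (f : ℝ → ℝ → E) : dtIter T 0 f = f := by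
  funext t s
  simp [dtIter]

lemma SmoothOnRect.dtIter (hT : 0 < T) (hf : SmoothOnRect T f) (k : ℕ) :
    SmoothOnRect T (dtIter T k f) := by
  induction k with
  | zero => rwa [dtIter_zero]
  | succ k ih => rw [dtIter_succ]; exact ih.dt hT

/-- Through this, conditions on `t`-derivatives of the curves that hold for every `s` become
conditions on the variation field. -/
lemma SmoothOnRect.ds_dtIter (hT : 0 < T) (hf : SmoothOnRect T f) (k : ℕ) :
    ∀ t ∈ Icc 0 T, ∀ s ∈ Icc (0 : ℝ) 1,
      ELMayer.ds (ELMayer.dtIter T k f) t s = ELMayer.dtIter T k (ELMayer.ds f) t s := by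
  induction k with
  | zero => intro t _ s _; rw [dtIter_zero, dtIter_zero]
  | succ k ih =>
    intro t ht s hs
    rw [dtIter_succ, dtIter_succ, (hf.dtIter hT k).ds_dt hT ht hs]
    exact dt_congr ht hs ih

lemma SmoothOnRect.slice_fst (hf : SmoothOnRect T f) (hs : s ∈ Icc (0 : ℝ) 1) :
    ContDiffOn ℝ ∞ (fun τ => f τ s) (Icc 0 T) :=
  ContDiffOn.comp (g := fun p : ℝ × ℝ => f p.1 p.2) hf
    (contDiff_id.prodMk contDiff_const).contDiffOn (fun _ hτ => ⟨hτ, hs⟩)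

lemma SmoothOnRect.slice_snd (hf : SmoothOnRect T f) (ht : t ∈ Icc 0 T) :
    ContDiffOn ℝ ∞ (fun v => f t v) (Icc 0 1) :=
  ContDiffOn.comp (g := fun p : ℝ × ℝ => f p.1 p.2) hf
    (contDiff_const.prodMk contDiff_id).contDiffOn (fun _ hv => ⟨ht, hv⟩)

lemma SmoothOnRect.add (hf : SmoothOnRect T f) (hg : SmoothOnRect T g) :
    SmoothOnRect T (fun t s => f t s + g t s) := ContDiffOn.add hf hg

lemma SmoothOnRect.sub (hf : SmoothOnRect T f) (hg : SmoothOnRect T g) :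
    SmoothOnRect T (fun t s => f t s - g t s) := ContDiffOn.sub hf hg

lemma SmoothOnRect.mul {f g : ℝ → ℝ → ℝ} (hf : SmoothOnRect T f) (hg : SmoothOnRect T g) :
    SmoothOnRect T (fun t s => f t s * g t s) := ContDiffOn.mul hf hg

lemma SmoothOnRect.const_mul {f : ℝ → ℝ → ℝ} (c : ℝ) (hf : SmoothOnRect T f) :
    SmoothOnRect T (fun t s => c * f t s) := ContDiffOn.mul contDiffOn_const hf

lemma SmoothOnRect.sum {ι : Type*} (I : Finset ι) {f : ι → ℝ → ℝ → E}
    (hf : ∀ i ∈ I, SmoothOnRect T (f i)) : SmoothOnRect T (fun t s => ∑ i ∈ I, f i t s) :=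
  ContDiffOn.sum hf

lemma SmoothOnRect.pi_apply {ι : Type*} [Fintype ι] {f : ℝ → ℝ → ι → ℝ}
    (hf : SmoothOnRect T f) (i : ι) : SmoothOnRect T (fun t s => f t s i) :=
  contDiffOn_pi.1 hf i

/-- Integrating a `t`-derivative over the rectangle. -/
lemma SmoothOnRect.integral_integral_dt {f : ℝ → ℝ → ℝ} (hT : 0 < T) (hf : SmoothOnRect T f) :
    ∫ t in (0 : ℝ)..T, ∫ s in (0 : ℝ)..1, ELMayer.dt T f t s
      = ∫ s in (0 : ℝ)..1, (f T s - f 0 s) := by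
  have hcont : ContinuousOn (fun p : ℝ × ℝ => ELMayer.dt T f p.1 p.2) (Icc 0 T ×ˢ Icc 0 1) :=
    ContDiffOn.continuousOn (hf.dt hT)
  have hint : Integrable (Function.uncurry (ELMayer.dt T f))
      ((volume.restrict (uIoc 0 T)).prod (volume.restrict (uIoc (0 : ℝ) 1))) := by
    rw [Measure.prod_restrict, uIoc_of_le hT.le, uIoc_of_le zero_le_one]
    exact (hcont.integrableOn_compact (isCompact_Icc.prod isCompact_Icc)).mono_set
      (prod_mono Ioc_subset_Icc_self Ioc_subset_Icc_self)
  simp_rw [intervalIntegral.integral_of_le (zero_le_one' ℝ)]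
  rw [uIoc_of_le (zero_le_one' ℝ)] at hint
  -- With the `t`-integral inside, the fundamental theorem applies for each fixed `s`.
  rw [intervalIntegral_integral_swap hint]
  refine setIntegral_congr_fun measurableSet_Ioc fun s hs => ?_
  have hs' := Ioc_subset_Icc_self hs
  refine intervalIntegral.integral_eq_sub_of_hasDerivAt_of_le hT.le
    (hf.slice_fst hs').continuousOn (fun t ht => ?_) ?_
  · exact (hf.hasDerivWithinAt_dt hT (Ioo_subset_Icc_self ht) hs').hasDerivAt
      (Icc_mem_nhds ht.1 ht.2)
  · exact ((hf.dt hT).slice_fst hs').continuousOn.intervalIntegrable_of_Icc hT.le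

/-- The fundamental theorem of calculus on `[a,b]`, with one-sided derivatives. -/
lemma integral_derivWithin_Icc {a b : ℝ} {φ : ℝ → ℝ} (hab : a < b)
    (hφ : ContDiffOn ℝ ∞ φ (Icc a b)) :
    ∫ v in a..b, derivWithin φ (Icc a b) v = φ b - φ a := by
  refine intervalIntegral.integral_eq_sub_of_hasDerivAt_of_le hab.le hφ.continuousOn
    (fun v hv => ?_) ?_
  · exact ((hφ.differentiableOn (by simp)) v (Ioo_subset_Icc_self hv)).hasDerivWithinAt.hasDerivAt
      (Icc_mem_nhds hv.1 hv.2)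
  · exact (hφ.continuousOn_derivWithin (uniqueDiffOn_Icc hab) (by simp)).intervalIntegrable_of_Icc
      hab.le

/-- Used to remove `∂_s ∫_0^s` from the correction term, up to and including the end points. -/
lemma derivWithin_integral_Icc {φ : ℝ → ℝ} (hφ : ContinuousOn φ (Icc 0 1))
    (hs : s ∈ Icc (0 : ℝ) 1) :
    derivWithin (fun v => ∫ w in (0 : ℝ)..v, φ w) (Icc 0 1) s = φ s := by
  -- The one-sided fundamental theorem finds its filter instance for `Icc` from this fact.
  have : Fact (s ∈ Icc (0 : ℝ) 1) := ⟨hs⟩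
  refine HasDerivWithinAt.derivWithin (intervalIntegral.integral_hasDerivWithinAt_right
    (t := Icc 0 1) ?_ ?_ (hφ s hs)) (uniqueDiffOn_Icc one_pos s hs)
  · exact (hφ.mono (Icc_subset_Icc_right hs.2)).intervalIntegrable_of_Icc hs.1
  · exact hφ.stronglyMeasurableAtFilter_nhdsWithin measurableSet_Icc s

end Rect

/-! ### Derivatives of components -/

lemma iteratedDerivWithin_pi_apply {ι : Type*} [Fintype ι] {S : Set ℝ} (hS : UniqueDiffOn ℝ S)
    {y : ℝ → ι → ℝ} (hy : ContDiffOn ℝ ∞ y S) (i : ι) (k : ℕ) :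
    ∀ t ∈ S, iteratedDerivWithin k y S t i = iteratedDerivWithin k (fun τ => y τ i) S t := by
  induction k with
  | zero => intro t _; simp
  | succ k ih =>
    intro t ht
    have h1 : HasDerivWithinAt (iteratedDerivWithin k y S)
        (iteratedDerivWithin (k + 1) y S t) S t := by
      rw [iteratedDerivWithin_succ]
      exact (hy.differentiableOn_iteratedDerivWithin (by exact_mod_cast WithTop.coe_lt_top k) hS t
        ht).hasDerivWithinAt
    have h2 := (hasDerivWithinAt_pi.1 h1 i).congr (fun τ hτ => (ih τ hτ).symm) (ih t ht).symm
    rw [iteratedDerivWithin_succ (f := fun τ => y τ i), h2.derivWithin (hS t ht)]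

/-! ### Momenta -/

/-- The alternating sums `∑_{ε ≤ r - m} (-1)^ε (d/dt)^ε a_{m+ε}`, on the rectangle. -/
def altSum (T : ℝ) (r : ℕ) (a : ℕ → ℝ → ℝ → ℝ) (m : ℕ) (t s : ℝ) : ℝ :=
  ∑ ε ∈ Finset.range (r + 1 - m), (-1) ^ ε * dtIter T ε (a (m + ε)) t s

section AltSum

variable {T : ℝ} {r : ℕ} {a : ℕ → ℝ → ℝ → ℝ} {t s : ℝ}

lemma smoothOnRect_altSum (hT : 0 < T) (ha : ∀ k, SmoothOnRect T (a k)) (m : ℕ) :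
    SmoothOnRect T (altSum T r a m) :=
  SmoothOnRect.sum _ fun ε _ => ((ha _).dtIter hT ε).const_mul _

lemma altSum_of_lt {m : ℕ} (h : r < m) : altSum T r a m t s = 0 := by
  rw [altSum, show r + 1 - m = 0 by omega]; simp

/-- Split off the term `ε = 0`; in the others one factor `-d/dt` comes out. This recursion drives
both the integration by parts in `sum_mul_dtIter` and the null Lagrangian computation. The case `m =
0` is the Euler-Lagrange expression, `m = β + 1` the momentum `p_β`. -/
lemma altSum_eq (hT : 0 < T) (ha : ∀ k, SmoothOnRect T (a k)) {m : ℕ} (hm : m ≤ r)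
    (ht : t ∈ Icc 0 T) (hs : s ∈ Icc (0 : ℝ) 1) :
    altSum T r a m t s = a m t s - dt T (altSum T r a (m + 1)) t s := by
  have h : dt T (altSum T r a (m + 1)) t s
      = ∑ ε ∈ Finset.range (r - m), (-1) ^ ε * dtIter T (ε + 1) (a (m + 1 + ε)) t s := by
    refine HasDerivWithinAt.derivWithin ?_ (uniqueDiffOn_Icc hT t ht)
    simp only [altSum, show r + 1 - (m + 1) = r - m by omega]
    refine HasDerivWithinAt.fun_sum fun ε _ => HasDerivWithinAt.const_mul _ ?_
    rw [dtIter_succ]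
    exact ((ha _).dtIter hT ε).hasDerivWithinAt_dt hT ht hs
  rw [h, altSum, show r + 1 - m = (r - m) + 1 by omega, Finset.sum_range_succ', add_comm,
    sub_eq_add_neg, ← Finset.sum_neg_distrib]
  simp only [pow_zero, dtIter_zero, one_mul, add_zero]
  congr 1
  refine Finset.sum_congr rfl fun ε _ => ?_
  rw [show m + (ε + 1) = m + 1 + ε by ring, pow_succ]; ring

/-- The first variation identity: `∑ a_m η_(m) = E η + d/dt ∑ p_m η_(m)`. -/
lemma sum_mul_dtIter (hT : 0 < T) (ha : ∀ k, SmoothOnRect T (a k)) {η : ℝ → ℝ → ℝ}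
    (hη : SmoothOnRect T η) (ht : t ∈ Icc 0 T) (hs : s ∈ Icc (0 : ℝ) 1) :
    ∑ m ∈ Finset.range (r + 1), a m t s * dtIter T m η t s
      = altSum T r a 0 t s * η t s
        + dt T (fun t s => ∑ m ∈ Finset.range r, altSum T r a (m + 1) t s * dtIter T m η t s)
            t s := by
  have h : dt T (fun t s => ∑ m ∈ Finset.range r, altSum T r a (m + 1) t s * dtIter T m η t s) t s
      = ∑ m ∈ Finset.range r, (dt T (altSum T r a (m + 1)) t s * dtIter T m η t s
          + altSum T r a (m + 1) t s * dtIter T (m + 1) η t s) := by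
    refine HasDerivWithinAt.derivWithin ?_ (uniqueDiffOn_Icc hT t ht)
    refine HasDerivWithinAt.fun_sum fun m _ => ?_
    rw [dtIter_succ]
    exact ((smoothOnRect_altSum hT ha _).hasDerivWithinAt_dt hT ht hs).mul
      ((hη.dtIter hT m).hasDerivWithinAt_dt hT ht hs)
  -- By the recursion each summand is a difference of consecutive terms `p_m η_(m)`, where `p_m =
  -- altSum T r a m`. The sum telescopes to `p_0 η - p_r η_(r)`, and `p_r = a_r` accounts for the
  -- top term `m = r`.
  have h0 : ∑ m ∈ Finset.range r, (a m t s * dtIter T m η t s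
        - (dt T (altSum T r a (m + 1)) t s * dtIter T m η t s
          + altSum T r a (m + 1) t s * dtIter T (m + 1) η t s))
      = ∑ m ∈ Finset.range r, (altSum T r a m t s * dtIter T m η t s
          - altSum T r a (m + 1) t s * dtIter T (m + 1) η t s) := by
    refine Finset.sum_congr rfl fun m hm => ?_
    rw [altSum_eq hT ha (Finset.mem_range.1 hm).le ht hs]; ring
  have hr : altSum T r a r t s = a r t s := by
    simp [altSum, dtIter_zero]
  rw [Finset.sum_range_sub', Finset.sum_sub_distrib, hr] at h0
  rw [h, Finset.sum_range_succ]
  simp only [dtIter_zero] at h0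
  linarith

end AltSum

/-! ### Jet coordinates -/

section JetCoord

variable {ι : Type} {n : ℕ}

lemma Jet.coord_of_le {x : Jet ι n} {k : ℕ} (hk : k ≤ n) (i : ι) :
    x.coord k i = x ⟨k, Nat.lt_succ_of_le hk⟩ i := by
  rw [Jet.coord, dif_pos (Nat.lt_succ_of_le hk)]

lemma Jet.coord_of_lt {x : Jet ι n} {k : ℕ} (hk : n < k) (i : ι) : x.coord k i = 0 := by
  rw [Jet.coord, dif_neg (by omega)]

lemma coord_coordVec [DecidableEq ι] {k : ℕ} (k' : ℕ) (i i' : ι) (hk' : k' ≤ n) :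
    (coordVec n k i).coord k' i' = if k' = k ∧ i' = i then 1 else 0 := by
  rw [Jet.coord, dif_pos (Nat.lt_succ_of_le hk')]; rfl

lemma Jet.eq_sum_coordVec [Fintype ι] [DecidableEq ι] (x : Jet ι n) :
    x = ∑ k ∈ Finset.range (n + 1), ∑ i, x.coord k i • coordVec n k i := by
  funext k' i'
  rw [Finset.sum_apply, Finset.sum_apply, Finset.sum_eq_single (k' : ℕ)]
  · rw [Finset.sum_apply, Finset.sum_apply, Finset.sum_eq_single i']
    · simp [coordVec, Jet.coord_of_le (Nat.le_of_lt_succ k'.2)]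
    · intro i _ hi
      simp [coordVec, hi.symm]
    · simp
  · intro k _ hk
    rw [Finset.sum_apply, Finset.sum_apply]
    refine Finset.sum_eq_zero fun i _ => ?_
    simp [coordVec, hk.symm]
  · intro h
    exact absurd (Finset.mem_range.2 k'.2) h

lemma ContinuousLinearMap.apply_jet [Fintype ι] [DecidableEq ι] {G : Type*}
    [NormedAddCommGroup G] [NormedSpace ℝ G] (A : Jet ι n →L[ℝ] G) (x : Jet ι n) :
    A x = ∑ k ∈ Finset.range (n + 1), ∑ i, x.coord k i • A (coordVec n k i) := by
  conv_lhs => rw [x.eq_sum_coordVec]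
  simp [map_sum]

/-- Reduces a partial derivative to a derivative in one real variable along a line, which is how the
partials of `hatL` are computed. -/
lemma jetPartial_eq_of_hasDerivAt [Fintype ι] [DecidableEq ι] {f : Jet ι n → ℝ}
    {x : Jet ι n} {k : ℕ} {i : ι} {d : ℝ} (hf : DifferentiableAt ℝ f x)
    (hd : HasDerivAt (fun ε : ℝ => f (x + ε • coordVec n k i)) d 0) :
    jetPartial f k i x = d := by
  have h : HasDerivAt (fun ε : ℝ => x + ε • coordVec n k i) (coordVec n k i) 0 := by
    simpa using ((hasDerivAt_id (0 : ℝ)).smul_const (coordVec n k i)).const_add x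
  have hf' : HasFDerivAt f (fderiv ℝ f x) (x + (0 : ℝ) • coordVec n k i) := by
    simpa using hf.hasFDerivAt
  exact (hf'.comp_hasDerivAt (0 : ℝ) h).unique hd

lemma isOpen_jet_zero_mem {Q : Set (ι → ℝ)} (hQ : IsOpen Q) :
    IsOpen {x : Jet ι n | x 0 ∈ Q} :=
  hQ.preimage (continuous_apply 0)

/-- A function on the jet space of actual order `m` has no derivatives in the directions of
the jet coordinates of order `> m`. -/
lemma fderiv_eq_zero_of_order [Fintype ι] {m : ℕ} {f : Jet ι n → ℝ} {x v : Jet ι n}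
    (hf : ∀ x', (∀ k : Fin (n + 1), (k : ℕ) ≤ m → x k = x' k) → f x = f x')
    (hv : ∀ k : Fin (n + 1), (k : ℕ) ≤ m → v k = 0) : fderiv ℝ f x v = 0 := by
  by_cases hd : DifferentiableAt ℝ f x
  · have h : HasDerivAt (fun ε : ℝ => x + ε • v) v 0 := by
      simpa using ((hasDerivAt_id (0 : ℝ)).smul_const v).const_add x
    have hf' : HasFDerivAt f (fderiv ℝ f x) (x + (0 : ℝ) • v) := by
      simpa using hd.hasFDerivAt
    refine (hf'.comp_hasDerivAt (0 : ℝ) h).unique ?_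
    have : (f ∘ fun ε : ℝ => x + ε • v) = fun _ => f x := by
      funext ε
      refine (hf _ fun k hk => ?_).symm
      simp [hv k hk]
    rw [this]
    exact hasDerivAt_const _ _
  -- Here `fderiv` takes its default value zero, so no differentiability has to be assumed.
  · simp [fderiv_zero_of_not_differentiableAt hd]

lemma coordVec_apply_eq_zero [DecidableEq ι] {k m : ℕ} (hm : m < k) (i : ι) (k' : Fin (n + 1))
    (hk' : (k' : ℕ) ≤ m) : coordVec n k i k' = 0 := by
  funext i'
  simp [coordVec, show (k' : ℕ) ≠ k by omega]

/-- Controls may lie on the boundary of `K`, but the jet variable can move freely because `Q` is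
open. -/
lemma eventually_mem_middle {M : ℕ} {Q : Set (ι → ℝ)}
    {K : Set (Fin M → ℝ)} (hQ : IsOpen Q) :
    ∀ z ∈ {z : ℝ × Jet ι n × (Fin M → ℝ) | z.2.1 0 ∈ Q ∧ z.2.2 ∈ K},
      ∀ᶠ x in nhds z.2.1,
        (z.1, x, z.2.2) ∈ {z : ℝ × Jet ι n × (Fin M → ℝ) | z.2.1 0 ∈ Q ∧ z.2.2 ∈ K} := by
  intro z hz
  filter_upwards [(isOpen_jet_zero_mem hQ).mem_nhds hz.1] with x hx
  exact ⟨hx, hz.2⟩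

end JetCoord

/-! ### Smoothness along families of curves -/

section Families

variable {ι : Type} [Fintype ι] {n : ℕ} {T : ℝ}
  {y : ℝ → ℝ → ι → ℝ} {t s : ℝ}

/-- The `n`-jets of a family of curves. -/
def jetFamily (T : ℝ) (n : ℕ) (y : ℝ → ℝ → ι → ℝ) (t s : ℝ) : Jet ι n :=
  jet T n (fun τ => y τ s) t

lemma jetFamily_apply (k : Fin (n + 1)) : jetFamily T n y t s k = dtIter T k y t s := rfl

lemma smoothOnRect_jetFamily (hT : 0 < T) (hy : SmoothOnRect T y) :
    SmoothOnRect T (jetFamily T n y) :=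
  contDiffOn_pi.2 fun k => hy.dtIter hT k

lemma dtIter_pi_apply (hT : 0 < T) (hy : SmoothOnRect T y) (k : ℕ) (i : ι)
    (ht : t ∈ Icc 0 T) (hs : s ∈ Icc (0 : ℝ) 1) :
    dtIter T k y t s i = dtIter T k (fun t s => y t s i) t s :=
  iteratedDerivWithin_pi_apply (uniqueDiffOn_Icc hT) (hy.slice_fst hs) i k t ht

lemma ds_pi_apply (hy : SmoothOnRect T y) (i : ι) (ht : t ∈ Icc 0 T) (hs : s ∈ Icc (0 : ℝ) 1) :
    ds y t s i = ds (fun t s => y t s i) t s :=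
  ((hasDerivWithinAt_pi.1 (hy.hasDerivWithinAt_ds ht hs) i).derivWithin
    (uniqueDiffOn_Icc one_pos s hs)).symm

lemma ds_jetFamily_coord (hT : 0 < T) (hy : SmoothOnRect T y) {k : ℕ} (hk : k ≤ n) (i : ι)
    (ht : t ∈ Icc 0 T) (hs : s ∈ Icc (0 : ℝ) 1) :
    (ds (jetFamily T n y) t s).coord k i = dtIter T k (ds fun t s => y t s i) t s := by
  rw [Jet.coord_of_le hk, ← (hy.pi_apply i).ds_dtIter hT k t ht s hs]
  have h := (smoothOnRect_jetFamily (n := n) hT hy).hasDerivWithinAt_ds ht hs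
  have h1 := hasDerivWithinAt_pi.1 (hasDerivWithinAt_pi.1 h ⟨k, Nat.lt_succ_of_le hk⟩) i
  rw [← h1.derivWithin (uniqueDiffOn_Icc one_pos s hs)]
  exact derivWithin_congr (fun v hv => dtIter_pi_apply hT hy k i ht hv)
    (dtIter_pi_apply hT hy k i ht hs)

lemma dt_jetFamily_coord (hT : 0 < T) (hy : SmoothOnRect T y) {k : ℕ} (hk : k ≤ n) (i : ι)
    (ht : t ∈ Icc 0 T) (hs : s ∈ Icc (0 : ℝ) 1) :
    (dt T (jetFamily T n y) t s).coord k i = dtIter T (k + 1) (fun t s => y t s i) t s := by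
  rw [Jet.coord_of_le hk, dtIter_succ]
  have h := (smoothOnRect_jetFamily (n := n) hT hy).hasDerivWithinAt_dt hT ht hs
  have h1 := hasDerivWithinAt_pi.1 (hasDerivWithinAt_pi.1 h ⟨k, Nat.lt_succ_of_le hk⟩) i
  rw [← h1.derivWithin (uniqueDiffOn_Icc hT t ht)]
  exact derivWithin_congr (fun v hv => dtIter_pi_apply hT hy k i hv hs)
    (dtIter_pi_apply hT hy k i ht hs)

lemma smoothOnRect_comp_lagrangian {M : ℕ} {Q : Set (ι → ℝ)} {K : Set (Fin M → ℝ)}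
    {u : ℝ → ℝ → Fin M → ℝ} (hT : 0 < T) {f : ℝ × Jet ι n × (Fin M → ℝ) → ℝ}
    (hf : ContDiffOn ℝ ∞ f {z | z.2.1 0 ∈ Q ∧ z.2.2 ∈ K})
    (hy : SmoothOnRect T y) (hu : SmoothOnRect T u)
    (hyQ : ∀ t ∈ Icc 0 T, ∀ s ∈ Icc (0 : ℝ) 1, y t s ∈ Q)
    (huK : ∀ t ∈ Icc 0 T, ∀ s ∈ Icc (0 : ℝ) 1, u t s ∈ K) :
    SmoothOnRect T (fun t s => f (t, jetFamily T n y t s, u t s)) := by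
  refine ContDiffOn.comp (g := f) hf (contDiffOn_fst.prodMk
    ((smoothOnRect_jetFamily (n := n) hT hy).prodMk hu)) fun p hp => ⟨?_, huK _ hp.1 _ hp.2⟩
  have : jetFamily T n y p.1 p.2 0 = y p.1 p.2 := by
    rw [jetFamily_apply, Fin.val_zero, dtIter_zero]
  simpa [this] using hyQ _ hp.1 _ hp.2

end Families

/-! ### Partial derivatives of functions that are smooth up to the boundary -/

section Partial

variable {A X B : Type*} [NormedAddCommGroup A] [NormedSpace ℝ A] [NormedAddCommGroup X]
  [NormedSpace ℝ X] [NormedAddCommGroup B] [NormedSpace ℝ B]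

/-- The slice through `z` in the middle variable stays in `S` near `z`, so a derivative within `S`
restricts to a genuine two-sided derivative on that slice. -/
lemma HasFDerivWithinAt.hasFDerivAt_middle {f : A × X × B → ℝ} {f' : A × X × B →L[ℝ] ℝ}
    {S : Set (A × X × B)} {z : A × X × B} (hf : HasFDerivWithinAt f f' S z)
    (hS : ∀ᶠ x in nhds z.2.1, (z.1, x, z.2.2) ∈ S) :
    HasFDerivAt (fun x => f (z.1, x, z.2.2))
      (f'.comp ((ContinuousLinearMap.inr ℝ A (X × B)).comp (ContinuousLinearMap.inl ℝ X B)))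
      z.2.1 := by
  have h : HasFDerivAt (fun x : X => (z.1, x, z.2.2))
      ((ContinuousLinearMap.inr ℝ A (X × B)).comp (ContinuousLinearMap.inl ℝ X B)) z.2.1 := by
    have := (hasFDerivAt_const z.1 z.2.1).prodMk
      ((hasFDerivAt_id (𝕜 := ℝ) z.2.1).prodMk (hasFDerivAt_const z.2.2 z.2.1))
    exact this
  have h' := HasFDerivWithinAt.comp (g := f) (t := S)
    (s := {x | (z.1, x, z.2.2) ∈ S}) z.2.1 hf h.hasFDerivWithinAt (fun x hx => hx)
  exact h'.hasFDerivAt hS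

/-- Partial derivatives in an open direction are smooth up to the boundary. -/
lemma ContDiffOn.fderiv_middle {f : A × X × B → ℝ} {S : Set (A × X × B)}
    (hf : ContDiffOn ℝ ∞ f S) (hS : ∀ z ∈ S, ∀ᶠ x in nhds z.2.1, (z.1, x, z.2.2) ∈ S) (v : X) :
    ContDiffOn ℝ ∞ (fun z => fderiv ℝ (fun x => f (z.1, x, z.2.2)) z.2.1 v) S := by
  refine contDiffOn_infty.2 fun m z hz => ?_
  have h1 : ContDiffWithinAt ℝ ((m : ℕ∞ω) + 1) f S z :=
    (hf z hz).of_le (by exact_mod_cast le_top)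
  -- Unique differentiability of `S` is not available, so a regular choice `f'` of derivatives is
  -- taken from the definition of `ContDiffWithinAt`. Its values on `(0, v, 0)` are independent of
  -- the choice, because they are two-sided derivatives.
  obtain ⟨U, hU, hUS, -, f', hf', hcf'⟩ :=
    (contDiffWithinAt_succ_iff_hasFDerivWithinAt' (by simp)).1 h1
  rw [insert_eq_of_mem hz] at hU hUS
  have h2 : ContDiffWithinAt ℝ m (fun w => f' w (0, v, 0)) S z :=
    hcf'.clm_apply contDiffWithinAt_const
  refine h2.congr_of_eventuallyEq ?_ ?_
  · filter_upwards [hU] with w hw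
    rw [(HasFDerivWithinAt.hasFDerivAt_middle (hf' w hw) (hS w (hUS hw))).fderiv]
    simp
  · have hzU := mem_of_mem_nhdsWithin hz hU
    rw [(HasFDerivWithinAt.hasFDerivAt_middle (hf' z hzU) (hS z hz)).fderiv]
    simp

end Partial

/-! ### The first variation of a Lagrangian with controls -/

section FirstVariation

variable {ι : Type} [Fintype ι] [DecidableEq ι] {M n r : ℕ} {T : ℝ} {Q : Set (ι → ℝ)}
  {K : Set (Fin M → ℝ)} {L : ℝ → Jet ι n → (Fin M → ℝ) → ℝ}
  {y : ℝ → ℝ → ι → ℝ} {u : ℝ → ℝ → Fin M → ℝ} {t s : ℝ}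

/-- The partial derivatives `∂L/∂y^i_(k)` along a family of curves and controls. -/
def partialFamily (T : ℝ) (L : ℝ → Jet ι n → (Fin M → ℝ) → ℝ) (u : ℝ → ℝ → Fin M → ℝ)
    (y : ℝ → ℝ → ι → ℝ) (i : ι) (k : ℕ) (t s : ℝ) : ℝ :=
  partialAlong T L (fun τ => u τ s) (fun τ => y τ s) k i t

lemma eulerLagrange_eq_altSum (i : ι) :
    eulerLagrange T r L (fun τ => u τ s) (fun τ => y τ s) i t
      = altSum T r (partialFamily T L u y i) 0 t s := by
  simp only [eulerLagrange, altSum, zero_add]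
  rfl

lemma momentum_eq_altSum (i : ι) (β : ℕ) :
    momentum T r L (fun τ => u τ s) (fun τ => y τ s) i β t
      = altSum T r (partialFamily T L u y i) (β + 1) t s := by
  simp only [momentum, altSum, Nat.add_sub_add_right,
    show ∀ ε, β + ε + 1 = β + 1 + ε by intro; ring]
  rfl

lemma smoothOnRect_partialFamily (hT : 0 < T) (hQ : IsOpen Q)
    (hL : ContDiffOn ℝ ∞ (fun z : ℝ × Jet ι n × (Fin M → ℝ) => L z.1 z.2.1 z.2.2)
      {z | z.2.1 0 ∈ Q ∧ z.2.2 ∈ K})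
    (hy : SmoothOnRect T y) (hu : SmoothOnRect T u)
    (hyQ : ∀ t ∈ Icc 0 T, ∀ s ∈ Icc (0 : ℝ) 1, y t s ∈ Q)
    (huK : ∀ t ∈ Icc 0 T, ∀ s ∈ Icc (0 : ℝ) 1, u t s ∈ K) (i : ι) (k : ℕ) :
    SmoothOnRect T (partialFamily T L u y i k) :=
  smoothOnRect_comp_lagrangian hT
    (ContDiffOn.fderiv_middle hL (eventually_mem_middle hQ) (coordVec n k i)) hy hu hyQ huK

/-- First variation formula. -/
theorem ds_lagrangian (hT : 0 < T) (hQ : IsOpen Q) (hr : r ≤ n)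
    (hL : ContDiffOn ℝ ∞ (fun z : ℝ × Jet ι n × (Fin M → ℝ) => L z.1 z.2.1 z.2.2)
      {z | z.2.1 0 ∈ Q ∧ z.2.2 ∈ K})
    (hLr : ∀ t, ∀ x x' : Jet ι n, ∀ w ∈ K, x 0 ∈ Q →
      (∀ k : Fin (n + 1), (k : ℕ) ≤ r → x k = x' k) → L t x w = L t x' w)
    (hy : SmoothOnRect T y) (hu : SmoothOnRect T u)
    (hyQ : ∀ t ∈ Icc 0 T, ∀ s ∈ Icc (0 : ℝ) 1, y t s ∈ Q)
    (huK : ∀ t ∈ Icc 0 T, ∀ s ∈ Icc (0 : ℝ) 1, u t s ∈ K)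
    (ht : t ∈ Icc 0 T) (hs : s ∈ Icc (0 : ℝ) 1) :
    ds (fun t s => L t (jetFamily T n y t s) (u t s)) t s
      = fderivWithin ℝ (fun w => L t (jetFamily T n y t s) w) K (u t s) (ds u t s)
        + ∑ i, (altSum T r (partialFamily T L u y i) 0 t s * ds (fun t s => y t s i) t s
          + dt T (fun t s => ∑ m ∈ Finset.range r, altSum T r (partialFamily T L u y i) (m + 1) t s
              * dtIter T m (ds fun t s => y t s i) t s) t s) := by
  set f := fun z : ℝ × Jet ι n × (Fin M → ℝ) => L z.1 z.2.1 z.2.2 with hf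
  set S := {z : ℝ × Jet ι n × (Fin M → ℝ) | z.2.1 0 ∈ Q ∧ z.2.2 ∈ K} with hS
  have hj0 : ∀ v ∈ Icc (0 : ℝ) 1, jetFamily T n y t v 0 ∈ Q := fun v hv => by
    rw [jetFamily_apply, Fin.val_zero, dtIter_zero]
    exact hyQ t ht v hv
  have hz : (t, jetFamily T n y t s, u t s) ∈ S := ⟨hj0 s hs, huK t ht s hs⟩
  have hf' := ((hL.differentiableOn (by simp)) _ hz).hasFDerivWithinAt
  set f' := fderivWithin ℝ f S (t, jetFamily T n y t s, u t s) with hf'def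
  have hjs := (smoothOnRect_jetFamily (n := n) hT hy).hasDerivWithinAt_ds ht hs
  have hus := hu.hasDerivWithinAt_ds ht hs
  have hmid := HasFDerivWithinAt.hasFDerivAt_middle hf' (eventually_mem_middle hQ _ hz)
  have htot : ds (fun t s => L t (jetFamily T n y t s) (u t s)) t s
      = f' (0, ds (jetFamily T n y) t s, ds u t s) := by
    have hc : HasDerivWithinAt (fun v => (t, jetFamily T n y t v, u t v))
        (0, ds (jetFamily T n y) t s, ds u t s) (Icc 0 1) s :=
      (hasDerivWithinAt_const s _ t).prodMk (hjs.prodMk hus)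
    have hm : MapsTo (fun v => (t, jetFamily T n y t v, u t v)) (Icc (0 : ℝ) 1) S :=
      fun v hv => ⟨hj0 v hv, huK t ht v hv⟩
    exact (hf'.comp_hasDerivWithinAt s hc hm).derivWithin (uniqueDiffOn_Icc one_pos s hs)
  have hcon : fderivWithin ℝ (fun w => L t (jetFamily T n y t s) w) K (u t s) (ds u t s)
      = f' (0, 0, ds u t s) := by
    have hm : MapsTo (fun v => u t v) (Icc (0 : ℝ) 1) K := fun v hv => huK t ht v hv
    have h1 : HasFDerivWithinAt (fun w : Fin M → ℝ => (t, jetFamily T n y t s, w))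
        ((ContinuousLinearMap.inr ℝ ℝ (Jet ι n × (Fin M → ℝ))).comp
          (ContinuousLinearMap.inr ℝ (Jet ι n) (Fin M → ℝ))) K (u t s) := by
      have := (hasFDerivWithinAt_const t (u t s) K).prodMk
        ((hasFDerivWithinAt_const (jetFamily T n y t s) (u t s) K).prodMk
          (hasFDerivWithinAt_id (𝕜 := ℝ) (u t s) K))
      exact this
    have h2 : HasFDerivWithinAt (fun w => L t (jetFamily T n y t s) w)
        (f'.comp ((ContinuousLinearMap.inr ℝ ℝ (Jet ι n × (Fin M → ℝ))).comp
          (ContinuousLinearMap.inr ℝ (Jet ι n) (Fin M → ℝ)))) K (u t s) :=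
      HasFDerivWithinAt.comp (g := f) (t := S) (u t s) hf' h1 (fun w hw => ⟨hj0 s hs, hw⟩)
    -- Two derivatives within `K` could differ as linear maps, but on the velocity of a curve in `K`
    -- both give the derivative of the composite.
    have h3 := h2.differentiableWithinAt.hasFDerivWithinAt.comp_hasDerivWithinAt s hus hm
    have h4 := h2.comp_hasDerivWithinAt s hus hm
    have hu1 := uniqueDiffOn_Icc one_pos s hs
    rw [← h3.derivWithin hu1, h4.derivWithin hu1]
    simp
  have hjet : f' (0, ds (jetFamily T n y) t s, 0)
      = ∑ k ∈ Finset.range (r + 1), ∑ i, partialFamily T L u y i k t s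
          * dtIter T k (ds fun t s => y t s i) t s := by
    have h1 : f' (0, ds (jetFamily T n y) t s, 0)
        = fderiv ℝ (fun x => L t x (u t s)) (jetFamily T n y t s) (ds (jetFamily T n y) t s) := by
      have : HasFDerivAt (fun x => L t x (u t s)) _ (jetFamily T n y t s) := hmid
      rw [this.fderiv]; simp
    rw [h1, ContinuousLinearMap.apply_jet]
    symm
    -- The sum over all jet coordinates stops at order `r`, the actual order of `L`.
    refine (Finset.sum_congr rfl fun k hk => Finset.sum_congr rfl fun i _ => ?_).trans
      (Finset.sum_subset (Finset.range_mono (Nat.succ_le_succ hr)) fun k _ hk =>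
        Finset.sum_eq_zero fun i _ => ?_)
    · have hk' : k ≤ n := by have := Finset.mem_range.1 hk; omega
      rw [ds_jetFamily_coord hT hy hk' i ht hs, smul_eq_mul, mul_comm]
      rfl
    · have hk' : r < k := by simpa using hk
      rw [fderiv_eq_zero_of_order (m := r)
        (fun x' hx' => hLr t _ x' _ (huK t ht s hs) (hj0 s hs) hx')
        (coordVec_apply_eq_zero hk' i), smul_zero]
  have hsplit : f' (0, ds (jetFamily T n y) t s, ds u t s)
      = f' (0, 0, ds u t s) + f' (0, ds (jetFamily T n y) t s, 0) := by
    rw [← map_add]; simp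
  rw [htot, hsplit, hcon, hjet, Finset.sum_comm]
  congr 1
  refine Finset.sum_congr rfl fun i _ => ?_
  exact sum_mul_dtIter hT (smoothOnRect_partialFamily hT hQ hL hy hu hyQ huK i)
    ((hy.pi_apply i).ds hT) ht hs

end FirstVariation

/-! ### Total derivatives -/

section TotalDeriv

variable {ι : Type} {n : ℕ}

lemma Jet.coord_add (x x' : Jet ι n) (k : ℕ) (i : ι) :
    (x + x').coord k i = x.coord k i + x'.coord k i := by
  unfold Jet.coord
  split_ifs <;> simp

lemma Jet.coord_smul (c : ℝ) (x : Jet ι n) (k : ℕ) (i : ι) :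
    (c • x).coord k i = c * x.coord k i := by
  unfold Jet.coord
  split_ifs <;> simp

variable [Fintype ι]

/-- The shift `(y, y_(1), …, y_(n)) ↦ (y_(1), …, y_(n), 0)` of jet coordinates. -/
def shiftJet (ι : Type) [Fintype ι] (n : ℕ) : Jet ι n →L[ℝ] Jet ι n :=
  LinearMap.toContinuousLinearMap
    { toFun := fun x k i => x.coord (k + 1) i
      map_add' := fun x x' => by
        funext k i
        exact Jet.coord_add x x' (k + 1) i
      map_smul' := fun c x => by
        funext k i
        exact Jet.coord_smul c x (k + 1) i }

lemma shiftJet_apply (x : Jet ι n) (k : Fin (n + 1)) (i : ι) :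
    shiftJet ι n x k i = x.coord (k + 1) i := rfl

lemma shiftJet_coord (x : Jet ι n) {k : ℕ} (hk : k ≤ n) (i : ι) :
    (shiftJet ι n x).coord k i = x.coord (k + 1) i := by
  rw [Jet.coord_of_le hk, shiftJet_apply]

lemma shiftJet_coordVec_zero [DecidableEq ι] (i : ι) : shiftJet ι n (coordVec n 0 i) = 0 := by
  funext k j
  rw [shiftJet_apply]
  by_cases h : (k : ℕ) + 1 < n + 1 <;> simp [Jet.coord, coordVec]

lemma shiftJet_coordVec_succ [DecidableEq ι] {k : ℕ} (hk : k + 1 ≤ n) (i : ι) :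
    shiftJet ι n (coordVec n (k + 1) i) = coordVec n k i := by
  funext k' j
  rw [shiftJet_apply]
  by_cases h : (k' : ℕ) + 1 ≤ n
  · rw [coord_coordVec _ _ _ h]; simp [coordVec]
  · rw [Jet.coord_of_lt (by omega)]
    simp [coordVec, show (k' : ℕ) ≠ k by omega]

variable {m : ℕ} {Q : Set (ι → ℝ)} {C : ℝ → Jet ι n → ℝ} {T : ℝ} {y : ℝ → ℝ → ι → ℝ} {t s : ℝ}

lemma contDiffAt_cost (hQ : IsOpen Q)
    (hC : ContDiffOn ℝ ∞ (fun z : ℝ × Jet ι n => C z.1 z.2) {z | z.2 0 ∈ Q})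
    {t : ℝ} {x : Jet ι n} (hx : x 0 ∈ Q) :
    ContDiffAt ℝ ∞ (fun z : ℝ × Jet ι n => C z.1 z.2) (t, x) :=
  hC.contDiffAt (((isOpen_jet_zero_mem hQ).preimage continuous_snd).mem_nhds hx)

lemma jetFamily_zero_mem (hyQ : ∀ t ∈ Icc 0 T, ∀ s ∈ Icc (0 : ℝ) 1, y t s ∈ Q)
    (ht : t ∈ Icc 0 T) (hs : s ∈ Icc (0 : ℝ) 1) : jetFamily T n y t s 0 ∈ Q := by
  rw [jetFamily_apply, Fin.val_zero, dtIter_zero]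
  exact hyQ t ht s hs

lemma smoothOnRect_comp_cost (hT : 0 < T) {G : Type*} [NormedAddCommGroup G] [NormedSpace ℝ G]
    {f : ℝ × Jet ι n → G} (hf : ContDiffOn ℝ ∞ f {z | z.2 0 ∈ Q}) (hy : SmoothOnRect T y)
    (hyQ : ∀ t ∈ Icc 0 T, ∀ s ∈ Icc (0 : ℝ) 1, y t s ∈ Q) :
    SmoothOnRect T (fun t s => f (t, jetFamily T n y t s)) :=
  ContDiffOn.comp (g := f) hf (contDiffOn_fst.prodMk (smoothOnRect_jetFamily (n := n) hT hy))
    fun _ hp => jetFamily_zero_mem hyQ hp.1 hp.2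

lemma hasFDerivAt_cost (hQ : IsOpen Q)
    (hC : ContDiffOn ℝ ∞ (fun z : ℝ × Jet ι n => C z.1 z.2) {z | z.2 0 ∈ Q})
    (t : ℝ) {x : Jet ι n} (hx : x 0 ∈ Q) :
    HasFDerivAt (C t) ((fderiv ℝ (fun z : ℝ × Jet ι n => C z.1 z.2) (t, x)).comp
      (ContinuousLinearMap.inr ℝ ℝ (Jet ι n))) x :=
  ((contDiffAt_cost hQ hC hx).differentiableAt (by simp)).hasFDerivAt.comp x
    (hasFDerivAt_prodMk_right t x)

lemma fderiv_cost (hQ : IsOpen Q)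
    (hC : ContDiffOn ℝ ∞ (fun z : ℝ × Jet ι n => C z.1 z.2) {z | z.2 0 ∈ Q})
    (t : ℝ) {x : Jet ι n} (hx : x 0 ∈ Q) (v : Jet ι n) :
    fderiv ℝ (C t) x v = fderiv ℝ (fun z : ℝ × Jet ι n => C z.1 z.2) (t, x) (0, v) := by
  rw [(hasFDerivAt_cost hQ hC t hx).fderiv]; simp

variable [DecidableEq ι]

/-- As a directional derivative along the field `(1, shiftJet x)`, `dC/dt` can itself be
differentiated by the product rule, which brings in the symmetric second derivative of `C`. -/
lemma totalDeriv_eq_fderiv (hQ : IsOpen Q)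
    (hC : ContDiffOn ℝ ∞ (fun z : ℝ × Jet ι n => C z.1 z.2) {z | z.2 0 ∈ Q})
    (t : ℝ) {x : Jet ι n} (hx : x 0 ∈ Q) :
    totalDeriv C t x
      = fderiv ℝ (fun z : ℝ × Jet ι n => C z.1 z.2) (t, x) (1, shiftJet ι n x) := by
  have h1 : deriv (fun τ => C τ x) t
      = fderiv ℝ (fun z : ℝ × Jet ι n => C z.1 z.2) (t, x) (1, 0) := by
    have h : HasDerivAt (fun τ : ℝ => (τ, x)) (1, 0) t :=
      (hasDerivAt_id t).prodMk (hasDerivAt_const t x)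
    exact (((contDiffAt_cost hQ hC hx).differentiableAt (by simp)).hasFDerivAt.comp_hasDerivAt t
      h).deriv
  have h2 : ((1 : ℝ), shiftJet ι n x) = (1, 0) + (0, shiftJet ι n x) := by simp
  rw [totalDeriv, h1, h2, map_add, ← fderiv_cost hQ hC t hx, ContinuousLinearMap.apply_jet,
    Finset.sum_range_succ]
  congr 1
  -- The shift puts zero in the top coordinate, which matches the sum over `k < n` in `totalDeriv`.
  have h3 : ∀ i, (shiftJet ι n x).coord n i = 0 := fun i => by
    rw [shiftJet_coord x le_rfl, Jet.coord_of_lt (Nat.lt_succ_self n)]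
  simp only [h3, zero_smul, Finset.sum_const_zero, add_zero]
  refine Finset.sum_congr rfl fun k hk => Finset.sum_congr rfl fun i _ => ?_
  rw [shiftJet_coord x (Finset.mem_range.1 hk).le, smul_eq_mul, mul_comm]
  rfl

/-- `dC/dt` is smooth. -/
lemma contDiffOn_totalDeriv (hQ : IsOpen Q)
    (hC : ContDiffOn ℝ ∞ (fun z : ℝ × Jet ι n => C z.1 z.2) {z | z.2 0 ∈ Q}) :
    ContDiffOn ℝ ∞ (fun z : ℝ × Jet ι n => totalDeriv C z.1 z.2) {z | z.2 0 ∈ Q} := by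
  have ho : IsOpen {z : ℝ × Jet ι n | z.2 0 ∈ Q} :=
    (isOpen_jet_zero_mem hQ).preimage continuous_snd
  refine ContDiffOn.congr ((hC.fderiv_of_isOpen ho (by simp)).clm_apply
    (contDiffOn_const.prodMk ((shiftJet ι n).contDiff.comp_contDiffOn contDiffOn_snd)))
    fun z hz => totalDeriv_eq_fderiv hQ hC z.1 hz

/-- The partial derivatives `∂C/∂y^i_(k)` along a family of curves. -/
def costPartialFamily (T : ℝ) (C : ℝ → Jet ι n → ℝ) (y : ℝ → ℝ → ι → ℝ) (i : ι) (k : ℕ)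
    (t s : ℝ) : ℝ :=
  jetPartial (C t) k i (jetFamily T n y t s)

lemma smoothOnRect_costPartialFamily (hT : 0 < T) (hQ : IsOpen Q)
    (hC : ContDiffOn ℝ ∞ (fun z : ℝ × Jet ι n => C z.1 z.2) {z | z.2 0 ∈ Q})
    (hy : SmoothOnRect T y) (hyQ : ∀ t ∈ Icc 0 T, ∀ s ∈ Icc (0 : ℝ) 1, y t s ∈ Q)
    (i : ι) (k : ℕ) : SmoothOnRect T (costPartialFamily T C y i k) := by
  have ho : IsOpen {z : ℝ × Jet ι n | z.2 0 ∈ Q} :=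
    (isOpen_jet_zero_mem hQ).preimage continuous_snd
  have h : ContDiffOn ℝ ∞ (fun z => fderiv ℝ (fun z : ℝ × Jet ι n => C z.1 z.2) z
      (0, coordVec n k i)) {z | z.2 0 ∈ Q} :=
    (hC.fderiv_of_isOpen ho (by simp)).clm_apply contDiffOn_const
  exact (smoothOnRect_comp_cost hT h hy hyQ).congr fun t ht s hs =>
    fderiv_cost hQ hC t (jetFamily_zero_mem hyQ ht hs) _

lemma costPartialFamily_eq_zero
    (hCm : ∀ t, ∀ x x' : Jet ι n, x 0 ∈ Q →
      (∀ k : Fin (n + 1), (k : ℕ) ≤ m → x k = x' k) → C t x = C t x')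
    (hyQ : ∀ t ∈ Icc 0 T, ∀ s ∈ Icc (0 : ℝ) 1, y t s ∈ Q) (i : ι) {k : ℕ} (hk : m < k)
    (ht : t ∈ Icc 0 T) (hs : s ∈ Icc (0 : ℝ) 1) : costPartialFamily T C y i k t s = 0 :=
  fderiv_eq_zero_of_order (fun x' hx' => hCm t _ x' (jetFamily_zero_mem hyQ ht hs) hx')
    (coordVec_apply_eq_zero hk i)

/-- The derivative of `dC/dt` in the direction of `v`, in terms of the derivative of
`∂C/∂v` along the curve. -/
lemma fderiv_totalDeriv (hT : 0 < T) (hQ : IsOpen Q)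
    (hC : ContDiffOn ℝ ∞ (fun z : ℝ × Jet ι n => C z.1 z.2) {z | z.2 0 ∈ Q})
    (hm : m < n)
    (hCm : ∀ t, ∀ x x' : Jet ι n, x 0 ∈ Q →
      (∀ k : Fin (n + 1), (k : ℕ) ≤ m → x k = x' k) → C t x = C t x')
    (hy : SmoothOnRect T y) (hyQ : ∀ t ∈ Icc 0 T, ∀ s ∈ Icc (0 : ℝ) 1, y t s ∈ Q)
    (ht : t ∈ Icc 0 T) (hs : s ∈ Icc (0 : ℝ) 1) (v : Jet ι n) :
    fderiv ℝ (totalDeriv C t) (jetFamily T n y t s) v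
      = dt T (fun t s => fderiv ℝ (C t) (jetFamily T n y t s) v) t s
        + fderiv ℝ (C t) (jetFamily T n y t s) (shiftJet ι n v) := by
  set c := fun z : ℝ × Jet ι n => C z.1 z.2 with hc
  set j := jetFamily T n y t s with hj
  have hj0 : j 0 ∈ Q := jetFamily_zero_mem hyQ ht hs
  have hcd : ContDiffAt ℝ ∞ c (t, j) := contDiffAt_cost hQ hC hj0
  have hD : HasFDerivAt (fderiv ℝ c) (fderiv ℝ (fderiv ℝ c) (t, j)) (t, j) :=
    ((hcd.fderiv_right (m := 1) (by norm_cast)).differentiableAt one_ne_zero).hasFDerivAt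
  have hsymm : IsSymmSndFDerivAt ℝ c (t, j) :=
    hcd.isSymmSndFDerivAt (by simpa using (by norm_cast : (2 : ℕ∞ω) ≤ ∞))
  have hlhs : fderiv ℝ (totalDeriv C t) j v
      = fderiv ℝ (fderiv ℝ c) (t, j) (0, v) (1, shiftJet ι n j)
        + fderiv ℝ c (t, j) (0, shiftJet ι n v) := by
    have h1 : HasFDerivAt (fun x => fderiv ℝ c (t, x)) _ j :=
      hD.comp j (hasFDerivAt_prodMk_right t j)
    have h2 : HasFDerivAt (fun x : Jet ι n => ((1 : ℝ), shiftJet ι n x)) _ j :=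
      (hasFDerivAt_const (1 : ℝ) j).prodMk (shiftJet ι n).hasFDerivAt
    have h3 := (h1.clm_apply h2).congr_of_eventuallyEq (f₁ := totalDeriv C t) (by
      filter_upwards [(isOpen_jet_zero_mem hQ).mem_nhds hj0] with x hx
      exact totalDeriv_eq_fderiv hQ hC t hx)
    rw [h3.fderiv]
    simp [add_comm]
  have hdj := (smoothOnRect_jetFamily (n := n) hT hy).hasDerivWithinAt_dt hT ht hs
  have hdt : dt T (fun t s => fderiv ℝ (C t) (jetFamily T n y t s) v) t s
      = fderiv ℝ (fderiv ℝ c) (t, j) (1, dt T (jetFamily T n y) t s) (0, v) := by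
    have h1 : HasDerivWithinAt (fun τ => (τ, jetFamily T n y τ s))
        (1, dt T (jetFamily T n y) t s) (Icc 0 T) t := (hasDerivWithinAt_id t _).prodMk hdj
    have h1' : HasDerivWithinAt (fun τ => fderiv ℝ c (τ, jetFamily T n y τ s))
        (fderiv ℝ (fderiv ℝ c) (t, j) (1, dt T (jetFamily T n y) t s)) (Icc 0 T) t :=
      hD.comp_hasDerivWithinAt t h1
    have h2 : HasDerivWithinAt (fun τ => fderiv ℝ c (τ, jetFamily T n y τ s) (0, v))
        (fderiv ℝ (fderiv ℝ c) (t, j) (1, dt T (jetFamily T n y) t s) (0, v)) (Icc 0 T) t := by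
      simpa using h1'.clm_apply (hasDerivWithinAt_const t (Icc 0 T) ((0 : ℝ), v))
    have h3 := h2.congr (f₁ := fun τ => fderiv ℝ (C τ) (jetFamily T n y τ s) v)
      (fun τ hτ => fderiv_cost hQ hC τ (jetFamily_zero_mem hyQ hτ hs) v)
      (fderiv_cost hQ hC t hj0 v)
    exact h3.derivWithin (uniqueDiffOn_Icc hT t ht)
  -- The velocity of the jet curve and the shifted jet agree except in the coordinates of order `n`.
  -- Since `m < n`, their difference `w` is invisible to `C`: the function `z ↦ D C(z)(0, w)`
  -- vanishes near `(t, j)`, hence so does its derivative.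
  have htop : fderiv ℝ (fderiv ℝ c) (t, j) (0, v)
      (0, dt T (jetFamily T n y) t s - shiftJet ι n j) = 0 := by
    set w := dt T (jetFamily T n y) t s - shiftJet ι n j with hw
    have hw0 : ∀ k : Fin (n + 1), (k : ℕ) ≤ m → w k = 0 := by
      intro k hk
      have hkn : (k : ℕ) + 1 ≤ n := by omega
      funext i
      have h1 := dt_jetFamily_coord hT hy (show (k : ℕ) ≤ n by omega) i ht hs
      rw [Jet.coord_of_le (show (k : ℕ) ≤ n by omega)] at h1
      rw [hw, Pi.sub_apply, Pi.sub_apply, h1, shiftJet_apply, hj, Jet.coord_of_le hkn,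
        jetFamily_apply, dtIter_pi_apply hT hy _ i ht hs, sub_self]
      rfl
    have h1 : HasFDerivAt (fun z => fderiv ℝ c z (0, w)) _ (t, j) :=
      hD.clm_apply (hasFDerivAt_const ((0 : ℝ), w) (t, j))
    have h2 : HasFDerivAt (fun z => fderiv ℝ c z (0, w)) (0 : ℝ × Jet ι n →L[ℝ] ℝ) (t, j) := by
      refine (hasFDerivAt_const (0 : ℝ) (t, j)).congr_of_eventuallyEq ?_
      filter_upwards [((isOpen_jet_zero_mem hQ).preimage
        (continuous_snd (X := ℝ))).mem_nhds hj0] with z hz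
      rw [← fderiv_cost hQ hC z.1 hz w]
      exact fderiv_eq_zero_of_order (fun x' hx' => hCm z.1 _ x' hz hx') hw0
    have h3 := congrArg (fun A : ℝ × Jet ι n →L[ℝ] ℝ => A (0, v)) (h1.unique h2)
    simpa using h3
  rw [hlhs, hdt, fderiv_cost hQ hC t hj0, hsymm (1, _) (0, v)]
  congr 1
  rw [← sub_eq_zero, ← map_sub, ← neg_eq_zero, ← map_neg]
  simpa using htop

lemma jetPartial_totalDeriv_zero (hT : 0 < T) (hQ : IsOpen Q)
    (hC : ContDiffOn ℝ ∞ (fun z : ℝ × Jet ι n => C z.1 z.2) {z | z.2 0 ∈ Q})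
    (hm : m < n)
    (hCm : ∀ t, ∀ x x' : Jet ι n, x 0 ∈ Q →
      (∀ k : Fin (n + 1), (k : ℕ) ≤ m → x k = x' k) → C t x = C t x')
    (hy : SmoothOnRect T y) (hyQ : ∀ t ∈ Icc 0 T, ∀ s ∈ Icc (0 : ℝ) 1, y t s ∈ Q)
    (ht : t ∈ Icc 0 T) (hs : s ∈ Icc (0 : ℝ) 1) (i : ι) :
    jetPartial (totalDeriv C t) 0 i (jetFamily T n y t s)
      = dt T (costPartialFamily T C y i 0) t s := by
  rw [jetPartial, fderiv_totalDeriv hT hQ hC hm hCm hy hyQ ht hs, shiftJet_coordVec_zero, map_zero,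
    add_zero]
  rfl

/-- The commutator of `∂/∂y_(k+1)` with `d/dt` is `∂/∂y_(k)`. -/
lemma jetPartial_totalDeriv_succ (hT : 0 < T) (hQ : IsOpen Q)
    (hC : ContDiffOn ℝ ∞ (fun z : ℝ × Jet ι n => C z.1 z.2) {z | z.2 0 ∈ Q})
    (hm : m < n)
    (hCm : ∀ t, ∀ x x' : Jet ι n, x 0 ∈ Q →
      (∀ k : Fin (n + 1), (k : ℕ) ≤ m → x k = x' k) → C t x = C t x')
    (hy : SmoothOnRect T y) (hyQ : ∀ t ∈ Icc 0 T, ∀ s ∈ Icc (0 : ℝ) 1, y t s ∈ Q)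
    (ht : t ∈ Icc 0 T) (hs : s ∈ Icc (0 : ℝ) 1) (i : ι) {k : ℕ} (hk : k + 1 ≤ n) :
    jetPartial (totalDeriv C t) (k + 1) i (jetFamily T n y t s)
      = dt T (costPartialFamily T C y i (k + 1)) t s + costPartialFamily T C y i k t s := by
  rw [jetPartial, fderiv_totalDeriv hT hQ hC hm hCm hy hyQ ht hs, shiftJet_coordVec_succ hk]
  rfl

end TotalDeriv

/-! ### Alternating sums of total derivatives -/

section AltSumTotal

variable {T : ℝ} {r : ℕ} {a b G : ℕ → ℝ → ℝ → ℝ} {t s : ℝ}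

lemma dtIter_congr {f g : ℝ → ℝ → ℝ} (k : ℕ) (ht : t ∈ Icc 0 T) (hs : s ∈ Icc (0 : ℝ) 1)
    (h : ∀ t ∈ Icc 0 T, ∀ s ∈ Icc (0 : ℝ) 1, f t s = g t s) :
    dtIter T k f t s = dtIter T k g t s :=
  iteratedDerivWithin_congr (fun τ hτ => h τ hτ s hs) ht

lemma altSum_congr (m : ℕ) (ht : t ∈ Icc 0 T) (hs : s ∈ Icc (0 : ℝ) 1)
    (h : ∀ k ≤ r, ∀ t ∈ Icc 0 T, ∀ s ∈ Icc (0 : ℝ) 1, a k t s = b k t s) :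
    altSum T r a m t s = altSum T r b m t s := by
  refine Finset.sum_congr rfl fun ε hε => ?_
  have : m + ε ≤ r := by have := Finset.mem_range.1 hε; omega
  rw [dtIter_congr ε ht hs (h _ this)]

lemma altSum_add (hT : 0 < T) (ha : ∀ k, SmoothOnRect T (a k)) (hb : ∀ k, SmoothOnRect T (b k))
    (m : ℕ) (ht : t ∈ Icc 0 T) (hs : s ∈ Icc (0 : ℝ) 1) :
    altSum T r (fun k t s => a k t s + b k t s) m t s
      = altSum T r a m t s + altSum T r b m t s := by
  rw [altSum, altSum, altSum, ← Finset.sum_add_distrib]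
  refine Finset.sum_congr rfl fun ε _ => ?_
  rw [← mul_add]
  congr 1
  exact iteratedDerivWithin_fun_add ht (uniqueDiffOn_Icc hT)
    (((ha _).slice_fst hs t ht).of_le (by exact_mod_cast le_top))
    (((hb _).slice_fst hs t ht).of_le (by exact_mod_cast le_top))

/-- If `b_0 = dG_0/dt` and `b_{k+1} = dG_{k+1}/dt + G_k`, where `G_r = 0`, then the alternating
sums of `b` are the functions `G_k`. -/
lemma altSum_total_succ (hT : 0 < T) (hG : ∀ k, SmoothOnRect T (G k))
    (hGr : ∀ t ∈ Icc 0 T, ∀ s ∈ Icc (0 : ℝ) 1, G r t s = 0)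
    (m : ℕ) (hm : m ≤ r) : ∀ t ∈ Icc 0 T, ∀ s ∈ Icc (0 : ℝ) 1,
      altSum T r (fun k t s => dt T (G k) t s + if k = 0 then 0 else G (k - 1) t s) (m + 1) t s
        = G m t s := by
  set b : ℕ → ℝ → ℝ → ℝ := fun k t s => dt T (G k) t s + if k = 0 then 0 else G (k - 1) t s
    with hb
  have hbs : ∀ k, SmoothOnRect T (b k) := by
    intro k
    refine ((hG k).dt hT).add ?_
    by_cases hk : k = 0
    · simp only [hk, if_true]; exact contDiffOn_const
    · simp only [hk, if_false]; exact hG _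
  -- Downward from `m = r`, where the sum is empty and `G_r = 0`. In the step, the recursion gives
  -- `b_{m+1} - dG_{m+1}/dt = G_m`.
  induction hm using Nat.decreasingInduction with
  | self =>
    intro t ht s hs
    rw [altSum_of_lt (Nat.lt_succ_self r), hGr t ht s hs]
  | of_succ k hk ih =>
    intro t ht s hs
    rw [altSum_eq hT hbs hk ht hs, dt_congr ht hs ih]
    simp [hb]

/-- A total derivative is a null Lagrangian: the recursion leaves `dG_0/dt - dG_0/dt`. -/
lemma altSum_total_zero (hT : 0 < T) (hG : ∀ k, SmoothOnRect T (G k))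
    (hGr : ∀ t ∈ Icc 0 T, ∀ s ∈ Icc (0 : ℝ) 1, G r t s = 0) (ht : t ∈ Icc 0 T)
    (hs : s ∈ Icc (0 : ℝ) 1) :
    altSum T r (fun k t s => dt T (G k) t s + if k = 0 then 0 else G (k - 1) t s) 0 t s = 0 := by
  rw [altSum_eq hT _ (Nat.zero_le r) ht hs,
    dt_congr ht hs (altSum_total_succ hT hG hGr 0 (Nat.zero_le r))]
  · simp
  · intro k
    refine ((hG k).dt hT).add ?_
    by_cases hk : k = 0
    · simp only [hk, if_true]; exact contDiffOn_const
    · simp only [hk, if_false]; exact hG _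

end AltSumTotal

/-! ### Partial derivatives of the modified Lagrangian -/

section HatPartials

variable {ι : Type} {n : ℕ}

lemma differentiable_coord [Fintype ι] (k : ℕ) (j : ι) :
    Differentiable ℝ fun x : Jet ι n => x.coord k j := by
  by_cases hk : k ≤ n
  · simp only [Jet.coord_of_le hk]; fun_prop
  · simp only [Jet.coord_of_lt (not_le.1 hk)]; fun_prop

lemma hasDerivAt_coord_line (x v : Jet ι n) (k : ℕ) (j : ι) :
    HasDerivAt (fun ε : ℝ => (x + ε • v).coord k j) (v.coord k j) 0 := by
  simp only [Jet.coord_add, Jet.coord_smul]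
  simpa using ((hasDerivAt_id (0 : ℝ)).mul_const (v.coord k j)).const_add (x.coord k j)

lemma hasDerivAt_comp_qJet_line {N r : ℕ} {f : Jet (Fin N) n → ℝ} {x : Jet (HatIdx N r) n}
    (hf : DifferentiableAt ℝ f (qJet x)) (v : Jet (HatIdx N r) n) :
    HasDerivAt (fun ε : ℝ => f (qJet (x + ε • v))) (fderiv ℝ f (qJet x) (qJet v)) 0 := by
  have h : HasDerivAt (fun ε : ℝ => qJet x + ε • qJet v) (qJet v) 0 := by
    simpa using ((hasDerivAt_id (0 : ℝ)).smul_const (qJet v)).const_add (qJet x)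
  have hf' : HasFDerivAt f (fderiv ℝ f (qJet x)) (qJet x + (0 : ℝ) • qJet v) := by
    simpa using hf.hasFDerivAt
  exact hf'.comp_hasDerivAt (0 : ℝ) h

lemma differentiableAt_comp_qJet {N r : ℕ} {f : Jet (Fin N) n → ℝ} {x : Jet (HatIdx N r) n}
    (hf : DifferentiableAt ℝ f (qJet x)) :
    DifferentiableAt ℝ (fun x : Jet (HatIdx N r) n => f (qJet x)) x := by
  have h : Differentiable ℝ (fun x : Jet (HatIdx N r) n => (qJet x : Jet (Fin N) n)) := by
    unfold qJet; fun_prop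
  exact hf.comp x (h x)

lemma qJet_coordVec_iq {N r : ℕ} (k : ℕ) (i : Fin N) :
    qJet (coordVec n k (iq i : HatIdx N r)) = coordVec n k i := by
  funext k' i'
  simp [qJet, coordVec]

lemma qJet_coordVec_inr {N r : ℕ} (k : ℕ) (j : (Fin 3 × Fin N × Fin r) ⊕ Fin 2) :
    qJet (coordVec n k (Sum.inr j : HatIdx N r)) = 0 := by
  funext k' i'
  simp [qJet, coordVec]

end HatPartials

namespace DefiningTriple

variable {N M : ℕ} (P : DefiningTriple N M)

lemma three_le_n : 3 ≤ P.n := by have := P.order_le; have := P.one_le_r; omega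

lemma hatr_le : P.hatr ≤ P.n := by
  have := P.order_le; have := P.three_le_n; unfold hatr; omega

lemma two_le_hatr : 2 ≤ P.hatr := le_max_right _ _

lemma differentiableAt_L (t : ℝ) {x : Jet (Fin N) P.n} (hx : x 0 ∈ P.Q) {w : Fin M → ℝ}
    (hw : w ∈ P.K) : DifferentiableAt ℝ (fun x => P.L t x w) x := by
  have hz : (t, x, w) ∈ {z : ℝ × Jet (Fin N) P.n × (Fin M → ℝ) | z.2.1 0 ∈ P.Q ∧ z.2.2 ∈ P.K} :=
    ⟨hx, hw⟩
  exact (HasFDerivWithinAt.hasFDerivAt_middle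
    ((P.L_smooth.differentiableOn (by simp)) _ hz).hasFDerivWithinAt
    (eventually_mem_middle P.isOpen_Q _ hz)).differentiableAt

lemma differentiableAt_totalDeriv (t : ℝ) {x : Jet (Fin N) P.n} (hx : x 0 ∈ P.Q) :
    DifferentiableAt ℝ (totalDeriv P.C t) x :=
  (hasFDerivAt_cost P.isOpen_Q (contDiffOn_totalDeriv P.isOpen_Q P.C_smooth) t hx).differentiableAt

lemma differentiableAt_hatL (t : ℝ) {x : Jet (HatIdx N P.r) P.n} (hx : qJet x 0 ∈ P.Q)
    {w : Fin M → ℝ} (hw : w ∈ P.K) : DifferentiableAt ℝ (fun x => P.hatL t x w) x := by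
  have h1 := differentiableAt_comp_qJet (P.differentiableAt_L t hx hw)
  have h2 := differentiableAt_comp_qJet (P.differentiableAt_totalDeriv t hx)
  have hc : ∀ k (j : HatIdx N P.r), DifferentiableAt ℝ
      (fun x : Jet (HatIdx N P.r) P.n => x.coord k j) x := fun k j => differentiable_coord k j x
  unfold hatL tildeL
  refine ((hc _ _).mul ((hc _ _).add ((h1.add ?_).add ?_))).add h2
  · refine DifferentiableAt.const_mul (DifferentiableAt.fun_sum fun i _ =>
      DifferentiableAt.fun_sum fun β _ => ?_) _
    exact (((hc _ _).pow 2).sub ((hc _ _).pow 2)).sub ((hc _ _).pow 2)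
  · refine DifferentiableAt.const_mul (DifferentiableAt.fun_sum fun i _ =>
      DifferentiableAt.fun_sum fun β _ => ?_) _
    exact (((hc _ _).pow 2).add (((hc _ _).pow 2).const_mul _)).add (((hc _ _).pow 2).const_mul _)

/-- The constant `(π/2T)⁴`. -/
def kappa : ℝ := (Real.pi / (2 * P.T)) ^ 4

/-- A single product-rule computation for all coordinates at once; for each type of variable only
Kronecker deltas remain to be evaluated. -/
lemma jetPartial_hatL (t : ℝ) {x : Jet (HatIdx N P.r) P.n} (hx : qJet x 0 ∈ P.Q)
    {w : Fin M → ℝ} (hw : w ∈ P.K) (k : ℕ) (j : HatIdx N P.r) :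
    jetPartial (fun x => P.hatL t x w) k j x
      = (coordVec P.n k j).coord 0 ilam * (x.coord 1 imu + P.tildeL t x w)
        + x.coord 0 ilam * ((coordVec P.n k j).coord 1 imu
          + (fderiv ℝ (fun x => P.L t x w) (qJet x) (qJet (coordVec P.n k j))
            + ∑ i : Fin N, ∑ β : Fin P.r,
              (x.coord 1 (ih i β) * (coordVec P.n k j).coord 1 (ih i β)
                - x.coord 2 (ih1 i β) * (coordVec P.n k j).coord 2 (ih1 i β)
                - x.coord 2 (ih2 i β) * (coordVec P.n k j).coord 2 (ih2 i β))
            + ∑ i : Fin N, ∑ β : Fin P.r,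
              (x.coord 0 (ih i β) * (coordVec P.n k j).coord 0 (ih i β)
                + P.kappa * (x.coord 0 (ih1 i β) * (coordVec P.n k j).coord 0 (ih1 i β))
                + P.kappa * (x.coord 0 (ih2 i β) * (coordVec P.n k j).coord 0 (ih2 i β)))))
        + fderiv ℝ (totalDeriv P.C t) (qJet x) (qJet (coordVec P.n k j)) := by
  refine jetPartial_eq_of_hasDerivAt (P.differentiableAt_hatL t hx hw) ?_
  generalize coordVec P.n k j = v
  have h1 := hasDerivAt_comp_qJet_line (P.differentiableAt_L t hx hw) v
  have h2 := hasDerivAt_comp_qJet_line (P.differentiableAt_totalDeriv t hx) v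
  have hc := hasDerivAt_coord_line x v
  have hc2 : ∀ k j, HasDerivAt (fun ε : ℝ => ((x + ε • v).coord k j) ^ 2)
      (2 * (x.coord k j * v.coord k j)) 0 := fun k j => by
    simpa [mul_assoc] using (hc k j).fun_pow 2
  unfold hatL tildeL
  have h3 := HasDerivAt.const_mul (1 / 2 : ℝ) (HasDerivAt.fun_sum (u := Finset.univ)
    fun (i : Fin N) _ => HasDerivAt.fun_sum (u := Finset.univ) fun (β : Fin P.r) _ =>
      ((hc2 1 (ih i β)).fun_sub (hc2 2 (ih1 i β))).fun_sub (hc2 2 (ih2 i β)))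
  have h4 := HasDerivAt.const_mul (1 / 2 : ℝ) (HasDerivAt.fun_sum (u := Finset.univ)
    fun (i : Fin N) _ => HasDerivAt.fun_sum (u := Finset.univ) fun (β : Fin P.r) _ =>
      ((hc2 0 (ih i β)).fun_add ((hc2 0 (ih1 i β)).const_mul P.kappa)).fun_add
        ((hc2 0 (ih2 i β)).const_mul P.kappa))
  have h5 := ((hc 0 ilam).fun_mul ((hc 1 imu).fun_add ((h1.fun_add h3).fun_add h4))).fun_add h2
  refine h5.congr_deriv ?_
  simp only [zero_smul, add_zero, Finset.mul_sum]
  congr 3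
  congr 1
  congr 1
  · congr 1
    exact Finset.sum_congr rfl fun i _ => Finset.sum_congr rfl fun β _ => by ring
  · exact Finset.sum_congr rfl fun i _ => Finset.sum_congr rfl fun β _ => by ring

variable {t : ℝ} {x : Jet (HatIdx N P.r) P.n} {w : Fin M → ℝ}

lemma jetPartial_hatL_iq (hx : qJet x 0 ∈ P.Q) (hw : w ∈ P.K) (k : ℕ) (i : Fin N) :
    jetPartial (fun x => P.hatL t x w) k (iq i) x
      = x.coord 0 ilam * jetPartial (fun x => P.L t x w) k i (qJet x)
        + jetPartial (totalDeriv P.C t) k i (qJet x) := by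
  have hn := P.three_le_n
  rw [P.jetPartial_hatL t hx hw, qJet_coordVec_iq]
  simp only [coord_coordVec _ _ _ (Nat.zero_le P.n), coord_coordVec _ _ _ (show 1 ≤ P.n by omega),
    coord_coordVec _ _ _ (show 2 ≤ P.n by omega)]
  simp [jetPartial]

lemma jetPartial_hatL_ilam (hx : qJet x 0 ∈ P.Q) (hw : w ∈ P.K) (k : ℕ) :
    jetPartial (fun x => P.hatL t x w) k ilam x
      = if k = 0 then x.coord 1 imu + P.tildeL t x w else 0 := by
  have hn := P.three_le_n
  rw [P.jetPartial_hatL t hx hw, qJet_coordVec_inr]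
  simp only [coord_coordVec _ _ _ (Nat.zero_le P.n), coord_coordVec _ _ _ (show 1 ≤ P.n by omega),
    coord_coordVec _ _ _ (show 2 ≤ P.n by omega)]
  simp [eq_comm]

lemma jetPartial_hatL_imu (hx : qJet x 0 ∈ P.Q) (hw : w ∈ P.K) (k : ℕ) :
    jetPartial (fun x => P.hatL t x w) k imu x = if k = 1 then x.coord 0 ilam else 0 := by
  have hn := P.three_le_n
  rw [P.jetPartial_hatL t hx hw, qJet_coordVec_inr]
  simp only [coord_coordVec _ _ _ (Nat.zero_le P.n), coord_coordVec _ _ _ (show 1 ≤ P.n by omega),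
    coord_coordVec _ _ _ (show 2 ≤ P.n by omega)]
  simp [eq_comm]

lemma sum_sum_ite_eq {A B : Type*} [Fintype A] [Fintype B] [DecidableEq A] [DecidableEq B]
    (g : A → B → ℝ) (i : A) (β : B) (p : Prop) [Decidable p] :
    ∑ i', ∑ β', g i' β' * (if p ∧ i' = i ∧ β' = β then 1 else 0) = if p then g i β else 0 := by
  by_cases hp : p
  · simp only [hp, true_and, if_true]
    rw [Finset.sum_eq_single i, Finset.sum_eq_single β] <;> simp +contextual
  · simp [hp]

lemma jetPartial_hatL_ih (hx : qJet x 0 ∈ P.Q) (hw : w ∈ P.K) (k : ℕ) (i : Fin N)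
    (β : Fin P.r) :
    jetPartial (fun x => P.hatL t x w) k (ih i β) x
      = x.coord 0 ilam * ((if 1 = k then x.coord 1 (ih i β) else 0)
        + if 0 = k then x.coord 0 (ih i β) else 0) := by
  have hn := P.three_le_n
  rw [P.jetPartial_hatL t hx hw, qJet_coordVec_inr]
  simp only [coord_coordVec _ _ _ (Nat.zero_le P.n), coord_coordVec _ _ _ (show 1 ≤ P.n by omega),
    coord_coordVec _ _ _ (show 2 ≤ P.n by omega), Sum.inr.injEq, Sum.inl.injEq, Prod.mk.injEq]
  simp [-mul_ite, sum_sum_ite_eq]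

lemma jetPartial_hatL_ih1 (hx : qJet x 0 ∈ P.Q) (hw : w ∈ P.K) (k : ℕ) (i : Fin N)
    (β : Fin P.r) :
    jetPartial (fun x => P.hatL t x w) k (ih1 i β) x
      = x.coord 0 ilam * (-(if 2 = k then x.coord 2 (ih1 i β) else 0)
        + P.kappa * if 0 = k then x.coord 0 (ih1 i β) else 0) := by
  have hn := P.three_le_n
  rw [P.jetPartial_hatL t hx hw, qJet_coordVec_inr]
  simp only [coord_coordVec _ _ _ (Nat.zero_le P.n), coord_coordVec _ _ _ (show 1 ≤ P.n by omega),
    coord_coordVec _ _ _ (show 2 ≤ P.n by omega), Sum.inr.injEq, Sum.inl.injEq, Prod.mk.injEq]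
  simp [-mul_ite, sum_sum_ite_eq, ← Finset.mul_sum]

lemma jetPartial_hatL_ih2 (hx : qJet x 0 ∈ P.Q) (hw : w ∈ P.K) (k : ℕ) (i : Fin N)
    (β : Fin P.r) :
    jetPartial (fun x => P.hatL t x w) k (ih2 i β) x
      = x.coord 0 ilam * (-(if 2 = k then x.coord 2 (ih2 i β) else 0)
        + P.kappa * if 0 = k then x.coord 0 (ih2 i β) else 0) := by
  have hn := P.three_le_n
  rw [P.jetPartial_hatL t hx hw, qJet_coordVec_inr]
  simp only [coord_coordVec _ _ _ (Nat.zero_le P.n), coord_coordVec _ _ _ (show 1 ≤ P.n by omega),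
    coord_coordVec _ _ _ (show 2 ≤ P.n by omega), Sum.inr.injEq, Sum.inl.injEq, Prod.mk.injEq]
  simp [-mul_ite, sum_sum_ite_eq, ← Finset.mul_sum]

end DefiningTriple

/-! ### The Euler-Lagrange equations of the modified Lagrangian -/

section Support

variable {ι : Type} [Fintype ι] [DecidableEq ι] {M n r : ℕ} {T : ℝ}
  {L : ℝ → Jet ι n → (Fin M → ℝ) → ℝ} {u : ℝ → Fin M → ℝ} {y : ℝ → ι → ℝ} {i : ι} {t : ℝ}

/-- The Euler-Lagrange expression when only the coordinates of order at most two occur. -/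
lemma eulerLagrange_eq_three (hr : 2 ≤ r) {A : ℕ → ℝ → ℝ}
    (h : ∀ k, EqOn (partialAlong T L u y k i) (A k) (Icc 0 T))
    (hA : ∀ k, 3 ≤ k → A k = fun _ => 0) (ht : t ∈ Icc 0 T) :
    eulerLagrange T r L u y i t
      = A 0 t - iteratedDerivWithin 1 (A 1) (Icc 0 T) t
        + iteratedDerivWithin 2 (A 2) (Icc 0 T) t := by
  have h1 : eulerLagrange T r L u y i t = ∑ β ∈ Finset.range (r + 1),
      (-1) ^ β * iteratedDerivWithin β (A β) (Icc 0 T) t :=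
    Finset.sum_congr rfl fun β _ => by rw [iteratedDerivWithin_congr (h β) ht]
  rw [h1, ← Finset.sum_subset (Finset.range_mono (show 3 ≤ r + 1 by omega))]
  · simp [Finset.sum_range_succ, sub_eq_add_neg]
  · intro β _ hβ
    rw [hA β (by simpa using hβ), iteratedDerivWithin_fun_const_zero]
    simp

end Support

namespace DefiningTriple

variable {N M : ℕ} {P : DefiningTriple N M} {u : ℝ → ℝ → Fin M → ℝ}
  {σ : ℝ → Jet (HatIdx N P.r) (2 * P.hatr - 1)} {F : ℝ → ℝ → HatIdx N P.r → ℝ} {t s : ℝ}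

/-- The `q`-part of a family of curves in the extended space. -/
def qFamily {N r : ℕ} (F : ℝ → ℝ → HatIdx N r → ℝ) (t s : ℝ) : Fin N → ℝ := fun i => F t s (iq i)

namespace IsHatVariation

lemma smooth (hF : P.IsHatVariation u σ F) : SmoothOnRect P.T F := hF.F_smooth

lemma smooth_u (hF : P.IsHatVariation u σ F) : SmoothOnRect P.T u := hF.u_smooth

lemma smooth_apply (hF : P.IsHatVariation u σ F) (j : HatIdx N P.r) :
    SmoothOnRect P.T (fun t s => F t s j) :=
  hF.smooth.pi_apply j

lemma smooth_q (hF : P.IsHatVariation u σ F) : SmoothOnRect P.T (qFamily F) :=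
  contDiffOn_pi.2 fun i => hF.smooth_apply (iq i)

lemma q_mem_Q (hF : P.IsHatVariation u σ F) :
    ∀ t ∈ Icc 0 P.T, ∀ s ∈ Icc (0 : ℝ) 1, qFamily F t s ∈ P.Q :=
  fun _ ht s hs => (hF.controlled s hs).solution.mapsTo ht

lemma u_mem_K (hF : P.IsHatVariation u σ F) :
    ∀ t ∈ Icc 0 P.T, ∀ s ∈ Icc (0 : ℝ) 1, u t s ∈ P.K :=
  fun _ ht s hs => (P.controls_smooth _ (hF.controlled s hs).q_mem).2 ht

lemma jet_coord_eq (hF : P.IsHatVariation u σ F)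
    (ht : t ∈ Icc 0 P.T) (hs : s ∈ Icc (0 : ℝ) 1) {k : ℕ} (hk : k ≤ P.n)
    (j : HatIdx N P.r) :
    (jetFamily P.T P.n F t s).coord k j = dtIter P.T k (fun t s => F t s j) t s := by
  rw [Jet.coord_of_le hk, jetFamily_apply, dtIter_pi_apply P.T_pos hF.smooth k j ht hs]

lemma qJet_jetFamily (hF : P.IsHatVariation u σ F)
    (ht : t ∈ Icc 0 P.T) (hs : s ∈ Icc (0 : ℝ) 1) :
    qJet (jetFamily P.T P.n F t s) = jetFamily P.T P.n (qFamily F) t s := by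
  funext k i
  rw [qJet, jetFamily_apply, jetFamily_apply, dtIter_pi_apply P.T_pos hF.smooth k _ ht hs,
    dtIter_pi_apply P.T_pos hF.smooth_q k i ht hs]
  rfl

lemma qJet_mem (hF : P.IsHatVariation u σ F)
    (ht : t ∈ Icc 0 P.T) (hs : s ∈ Icc (0 : ℝ) 1) :
    qJet (jetFamily P.T P.n F t s) 0 ∈ P.Q := by
  rw [hF.qJet_jetFamily ht hs]
  exact jetFamily_zero_mem hF.q_mem_Q ht hs

lemma eulerLagrange_eq_zero (hF : P.IsHatVariation u σ F)
    (ht : t ∈ Icc 0 P.T) (hs : s ∈ Icc (0 : ℝ) 1) (j : HatIdx N P.r) :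
    eulerLagrange P.T P.hatr P.hatL (fun τ => u τ s) (fun τ => F τ s) j t = 0 :=
  (hF.controlled s hs).solution.eq_zero j t ht

/-- `μ` enters the modified Lagrangian only through `λ μ_(1)`, so its Euler-Lagrange equation is
`-dλ/dt = 0`; the initial value is `1`. -/
lemma lam_eq_one (hF : P.IsHatVariation u σ F)
    (ht : t ∈ Icc 0 P.T) (hs : s ∈ Icc (0 : ℝ) 1) : F t s ilam = 1 := by
  have hn := P.three_le_n
  have hd : ∀ t ∈ Icc 0 P.T, derivWithin (fun τ => F τ s ilam) (Icc 0 P.T) t = 0 := by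
    intro t ht
    have h := eulerLagrange_eq_three (T := P.T) (L := P.hatL) (u := fun τ => u τ s)
      (y := fun τ => F τ s) (i := imu)
      (A := fun k τ => if k = 1 then F τ s ilam else 0) P.two_le_hatr (fun k τ hτ => by
        refine (P.jetPartial_hatL_imu (hF.qJet_mem hτ hs) (hF.u_mem_K τ hτ s hs) k).trans ?_
        rw [hF.jet_coord_eq hτ hs (Nat.zero_le _), dtIter_zero])
      (fun k hk => by simp [show k ≠ 1 by omega]) ht
    rw [hF.eulerLagrange_eq_zero ht hs] at h
    simpa [iteratedDerivWithin_one] using h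
  rw [constant_of_derivWithin_zero
    (((hF.smooth_apply ilam).slice_fst hs).differentiableOn (by simp))
    (fun τ hτ => hd τ (Ico_subset_Icc_self hτ)) t ht]
  simpa [comp] using (hF.controlled s hs).lam_zero

lemma jet_lam (hF : P.IsHatVariation u σ F)
    (ht : t ∈ Icc 0 P.T) (hs : s ∈ Icc (0 : ℝ) 1) :
    (jetFamily P.T P.n F t s).coord 0 ilam = 1 := by
  rw [hF.jet_coord_eq ht hs (Nat.zero_le _), dtIter_zero, hF.lam_eq_one ht hs]

/-- The Euler-Lagrange equation of `λ`, which occurs linearly and without derivatives. -/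
lemma mu_add_tildeL (hF : P.IsHatVariation u σ F)
    (ht : t ∈ Icc 0 P.T) (hs : s ∈ Icc (0 : ℝ) 1) :
    dtIter P.T 1 (fun t s => F t s imu) t s
      + P.tildeL t (jetFamily P.T P.n F t s) (u t s) = 0 := by
  have hn := P.three_le_n
  have h := eulerLagrange_eq_three (T := P.T) (L := P.hatL) (u := fun τ => u τ s)
    (y := fun τ => F τ s) (i := ilam)
    (A := fun k τ => if k = 0 then dtIter P.T 1 (fun t s => F t s imu) τ s
      + P.tildeL τ (jetFamily P.T P.n F τ s) (u τ s) else 0) P.two_le_hatr (fun k τ hτ => by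
      refine (P.jetPartial_hatL_ilam (hF.qJet_mem hτ hs) (hF.u_mem_K τ hτ s hs) k).trans ?_
      rw [hF.jet_coord_eq hτ hs (show 1 ≤ P.n by omega)])
    (fun k hk => by simp [show k ≠ 0 by omega]) ht
  rw [hF.eulerLagrange_eq_zero ht hs] at h
  simpa using h.symm

/-- With `λ = 1` the Euler-Lagrange equation of `h` is `h - h_(2) = 0`. -/
lemma h_eq (hF : P.IsHatVariation u σ F)
    (ht : t ∈ Icc 0 P.T) (hs : s ∈ Icc (0 : ℝ) 1) (i : Fin N) (β : Fin P.r) :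
    dtIter P.T 2 (fun t s => F t s (ih i β)) t s = F t s (ih i β) := by
  have hn := P.three_le_n
  have h := eulerLagrange_eq_three (T := P.T) (L := P.hatL) (u := fun τ => u τ s)
    (y := fun τ => F τ s) (i := ih i β)
    (A := fun k τ => (if 1 = k then dtIter P.T 1 (fun t s => F t s (ih i β)) τ s else 0)
      + if 0 = k then F τ s (ih i β) else 0) P.two_le_hatr (fun k τ hτ => by
      refine (P.jetPartial_hatL_ih (hF.qJet_mem hτ hs) (hF.u_mem_K τ hτ s hs) k i β).trans ?_
      rw [hF.jet_lam hτ hs,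
        hF.jet_coord_eq hτ hs (show 1 ≤ P.n by omega), hF.jet_coord_eq hτ hs (Nat.zero_le _),
        dtIter_zero, one_mul])
    (fun k hk => by simp [show 1 ≠ k by omega, show 0 ≠ k by omega]) ht
  rw [hF.eulerLagrange_eq_zero ht hs] at h
  have h2 : dtIter P.T 2 (fun t s => F t s (ih i β)) t s
      = iteratedDerivWithin 1 (fun τ => dtIter P.T 1 (fun t s => F t s (ih i β)) τ s)
          (Icc 0 P.T) t := by
    rw [dtIter_succ, iteratedDerivWithin_one]; rfl
  have h3 : F t s (ih i β) - iteratedDerivWithin 1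
      (fun τ => dtIter P.T 1 (fun t s => F t s (ih i β)) τ s) (Icc 0 P.T) t = 0 := by
    simpa using h.symm
  rw [h2]
  linarith

/-- Shared by `h'` and `h''`: a Lagrangian `½(κ f² - f_(2)²)` has Euler-Lagrange equation `κ f -
f_(4) = 0`. -/
lemma h1_aux (hF : P.IsHatVariation u σ F) (j : HatIdx N P.r)
    (hj : ∀ t ∈ Icc 0 P.T, ∀ k, partialAlong P.T P.hatL (fun τ => u τ s) (fun τ => F τ s) k j t
      = -(if 2 = k then dtIter P.T 2 (fun t s => F t s j) t s else 0)
        + P.kappa * if 0 = k then F t s j else 0)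
    (ht : t ∈ Icc 0 P.T) (hs : s ∈ Icc (0 : ℝ) 1) :
    dtIter P.T 4 (fun t s => F t s j) t s = P.kappa * F t s j := by
  have h := eulerLagrange_eq_three (T := P.T) (L := P.hatL) (u := fun τ => u τ s)
    (y := fun τ => F τ s) (i := j)
    (A := fun k τ => -(if 2 = k then dtIter P.T 2 (fun t s => F t s j) τ s else 0)
        + P.kappa * if 0 = k then F τ s j else 0) P.two_le_hatr (fun k τ hτ => hj τ hτ k)
    (fun k hk => by simp [show 2 ≠ k by omega, show 0 ≠ k by omega]) ht
  rw [hF.eulerLagrange_eq_zero ht hs] at h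
  have h2 : dtIter P.T 4 (fun t s => F t s j) t s
      = iteratedDerivWithin 2 (fun τ => dtIter P.T 2 (fun t s => F t s j) τ s) (Icc 0 P.T) t := by
    rw [dtIter_succ, dtIter_succ]
    change _ = dtIter P.T 2 (dtIter P.T 2 (fun t s => F t s j)) t s
    rw [dtIter_succ 1 (dtIter P.T 2 _), dtIter_succ 0 (dtIter P.T 2 _), dtIter_zero]
  rw [h2]
  simp [iteratedDerivWithin_fun_neg] at h
  linarith

lemma h1_eq (hF : P.IsHatVariation u σ F)
    (ht : t ∈ Icc 0 P.T) (hs : s ∈ Icc (0 : ℝ) 1) (i : Fin N) (β : Fin P.r) :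
    dtIter P.T 4 (fun t s => F t s (ih1 i β)) t s = P.kappa * F t s (ih1 i β) := by
  have hn := P.three_le_n
  refine hF.h1_aux _ (fun τ hτ k => ?_) ht hs
  refine (P.jetPartial_hatL_ih1 (hF.qJet_mem hτ hs) (hF.u_mem_K τ hτ s hs) k i β).trans ?_
  rw [hF.jet_lam hτ hs,
    hF.jet_coord_eq hτ hs (show 2 ≤ P.n by omega), hF.jet_coord_eq hτ hs (Nat.zero_le _),
    dtIter_zero, one_mul]

lemma h2_eq (hF : P.IsHatVariation u σ F)
    (ht : t ∈ Icc 0 P.T) (hs : s ∈ Icc (0 : ℝ) 1) (i : Fin N) (β : Fin P.r) :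
    dtIter P.T 4 (fun t s => F t s (ih2 i β)) t s = P.kappa * F t s (ih2 i β) := by
  have hn := P.three_le_n
  refine hF.h1_aux _ (fun τ hτ k => ?_) ht hs
  refine (P.jetPartial_hatL_ih2 (hF.qJet_mem hτ hs) (hF.u_mem_K τ hτ s hs) k i β).trans ?_
  rw [hF.jet_lam hτ hs,
    hF.jet_coord_eq hτ hs (show 2 ≤ P.n by omega), hF.jet_coord_eq hτ hs (Nat.zero_le _),
    dtIter_zero, one_mul]

/-! The `q`-part. -/

lemma smooth_partialL (hF : P.IsHatVariation u σ F) (i : Fin N) (k : ℕ) :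
    SmoothOnRect P.T (partialFamily P.T P.L u (qFamily F) i k) :=
  smoothOnRect_partialFamily P.T_pos P.isOpen_Q P.L_smooth hF.smooth_q hF.smooth_u hF.q_mem_Q
    hF.u_mem_K i k

lemma smooth_partialC (hF : P.IsHatVariation u σ F) (i : Fin N) (k : ℕ) :
    SmoothOnRect P.T (costPartialFamily P.T P.C (qFamily F) i k) :=
  smoothOnRect_costPartialFamily P.T_pos P.isOpen_Q P.C_smooth hF.smooth_q hF.q_mem_Q i k

lemma partialC_eq_zero (hF : P.IsHatVariation u σ F) (i : Fin N) {k : ℕ} (hk : P.r ≤ k) :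
    ∀ t ∈ Icc 0 P.T, ∀ s ∈ Icc (0 : ℝ) 1, costPartialFamily P.T P.C (qFamily F) i k t s = 0 :=
  fun _ ht _ hs => costPartialFamily_eq_zero P.C_order hF.q_mem_Q i
    (show P.r - 1 < k by have := P.one_le_r; omega) ht hs

/-- The partial derivatives of `dC/dt` along the family. -/
lemma partial_totalDeriv (hF : P.IsHatVariation u σ F)
    (ht : t ∈ Icc 0 P.T) (hs : s ∈ Icc (0 : ℝ) 1) (i : Fin N) {k : ℕ}
    (hk : k ≤ P.n) :
    jetPartial (totalDeriv P.C t) k i (jetFamily P.T P.n (qFamily F) t s)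
      = dt P.T (costPartialFamily P.T P.C (qFamily F) i k) t s
        + if k = 0 then 0 else costPartialFamily P.T P.C (qFamily F) i (k - 1) t s := by
  have hm : P.r - 1 < P.n := by have := P.order_le; have := P.one_le_r; omega
  cases k with
  | zero =>
    rw [jetPartial_totalDeriv_zero P.T_pos P.isOpen_Q P.C_smooth hm P.C_order hF.smooth_q
      hF.q_mem_Q ht hs]
    simp
  | succ k =>
    rw [jetPartial_totalDeriv_succ P.T_pos P.isOpen_Q P.C_smooth hm P.C_order hF.smooth_q
      hF.q_mem_Q ht hs i hk]
    simp

lemma smooth_total (hF : P.IsHatVariation u σ F) (i : Fin N) (k : ℕ) :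
    SmoothOnRect P.T (fun t s => dt P.T (costPartialFamily P.T P.C (qFamily F) i k) t s
        + if k = 0 then 0 else costPartialFamily P.T P.C (qFamily F) i (k - 1) t s) := by
  refine ((hF.smooth_partialC i k).dt P.T_pos).add ?_
  by_cases hk : k = 0
  · simp only [hk, if_true]; exact contDiffOn_const
  · simp only [hk, if_false]; exact hF.smooth_partialC i _

lemma partialL_eq_zero (hF : P.IsHatVariation u σ F) (i : Fin N) {k : ℕ} (hk : P.r < k) :
    ∀ t ∈ Icc 0 P.T, ∀ s ∈ Icc (0 : ℝ) 1, partialFamily P.T P.L u (qFamily F) i k t s = 0 :=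
  fun t ht s hs => fderiv_eq_zero_of_order
    (fun x' hx' => P.L_order t _ x' _ (hF.u_mem_K t ht s hs)
      (jetFamily_zero_mem hF.q_mem_Q ht hs) hx')
    (coordVec_apply_eq_zero hk i)

/-- The curves solve the Euler-Lagrange equations of `L`. -/
lemma eulerLagrange_L (hF : P.IsHatVariation u σ F)
    (ht : t ∈ Icc 0 P.T) (hs : s ∈ Icc (0 : ℝ) 1) (i : Fin N) :
    altSum P.T P.r (partialFamily P.T P.L u (qFamily F) i) 0 t s = 0 := by
  have h := hF.eulerLagrange_eq_zero ht hs (iq i)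
  rw [eulerLagrange_eq_altSum, altSum_congr (b := fun k t s =>
      partialFamily P.T P.L u (qFamily F) i k t s
        + (dt P.T (costPartialFamily P.T P.C (qFamily F) i k) t s
        + if k = 0 then 0 else costPartialFamily P.T P.C (qFamily F) i (k - 1) t s)) 0 ht hs,
    altSum_add P.T_pos (hF.smooth_partialL i) (hF.smooth_total i) 0 ht hs,
    altSum_total_zero (r := P.hatr) P.T_pos (hF.smooth_partialC i)
      (hF.partialC_eq_zero i (le_max_left _ _)) ht hs, add_zero] at h
  -- The equation has order `max {r, 2}`; the terms beyond `r` vanish because `L` has actual order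
  -- `r`.
  · rw [← h, altSum, altSum]
    refine Finset.sum_subset (Finset.range_mono (by
      have : P.r ≤ P.hatr := le_max_left _ _
      omega)) fun k _ hk => ?_
    rw [dtIter_congr (g := fun _ _ => 0) k ht hs
      (hF.partialL_eq_zero i (show P.r < 0 + k by simp at hk; omega)), dtIter,
      iteratedDerivWithin_fun_const_zero, mul_zero]
  · intro k hk t ht s hs
    refine (P.jetPartial_hatL_iq (hF.qJet_mem ht hs) (hF.u_mem_K t ht s hs) k i).trans ?_
    rw [hF.jet_lam ht hs, one_mul,
      hF.qJet_jetFamily ht hs, hF.partial_totalDeriv ht hs i (hk.trans P.hatr_le)]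
    rfl

lemma momentum_L (i : Fin N) (β : ℕ) :
    momentum P.T P.r P.L (fun τ => u τ s) (qCurve fun τ => F τ s) i β t
      = altSum P.T P.r (partialFamily P.T P.L u (qFamily F) i) (β + 1) t s :=
  momentum_eq_altSum (y := qFamily F) i β

/-- Momenta are additive, and by `altSum_total_succ` those of `dC/dt` are the partials `∂C/∂q_(β)`.
This is how `C` enters through the terminal condition on `h'`. -/
lemma momentum_LdC (hF : P.IsHatVariation u σ F)
    (ht : t ∈ Icc 0 P.T) (hs : s ∈ Icc (0 : ℝ) 1) (i : Fin N) {β : ℕ}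
    (hβ : β ≤ P.r) :
    momentum P.T P.r P.LdC (fun τ => u τ s) (qCurve fun τ => F τ s) i β t
      = altSum P.T P.r (partialFamily P.T P.L u (qFamily F) i) (β + 1) t s
        + costPartialFamily P.T P.C (qFamily F) i β t s := by
  refine (momentum_eq_altSum (u := u) (y := qFamily F) (L := P.LdC) i β).trans ?_
  rw [altSum_congr (b := fun k t s =>
      partialFamily P.T P.L u (qFamily F) i k t s
        + (dt P.T (costPartialFamily P.T P.C (qFamily F) i k) t s
        + if k = 0 then 0 else costPartialFamily P.T P.C (qFamily F) i (k - 1) t s)) (β + 1) ht hs,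
    altSum_add P.T_pos (hF.smooth_partialL i) (hF.smooth_total i) _ ht hs,
    altSum_total_succ P.T_pos (hF.smooth_partialC i) (hF.partialC_eq_zero i le_rfl) β hβ t ht s hs]
  intro k hk t ht s hs
  have hk' : k ≤ P.n := by have := P.order_le; omega
  rw [← hF.partial_totalDeriv ht hs i hk']
  have h0 := jetFamily_zero_mem (n := P.n) hF.q_mem_Q ht hs
  have h := fderiv_fun_add (P.differentiableAt_L t h0 (hF.u_mem_K t ht s hs))
    (P.differentiableAt_totalDeriv t h0)
  exact congrArg (fun A : Jet (Fin N) P.n →L[ℝ] ℝ => A (coordVec P.n k i)) h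

end IsHatVariation

end DefiningTriple

/-! ### Differentiating boundary conditions in the variation parameter -/

section Boundary

variable {T : ℝ} {f g : ℝ → ℝ → ℝ} {t s : ℝ}

/-- A boundary condition at fixed `t` holds for every `s`, so it passes to `∂_s`, which commutes
with the `t`-derivatives. -/
lemma dtIter_ds_eq_of_eq (hT : 0 < T) (hf : SmoothOnRect T f) (hg : SmoothOnRect T g) {k l : ℕ}
    (ht : t ∈ Icc 0 T) (hs : s ∈ Icc (0 : ℝ) 1)
    (h : ∀ s ∈ Icc (0 : ℝ) 1, dtIter T k f t s = dtIter T l g t s) :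
    dtIter T k (ds f) t s = dtIter T l (ds g) t s := by
  rw [← hf.ds_dtIter hT k t ht s hs, ← hg.ds_dtIter hT l t ht s hs]
  exact derivWithin_congr h (h s hs)

lemma dtIter_ds_eq_zero_of_eq (hT : 0 < T) (hf : SmoothOnRect T f) {k : ℕ}
    (ht : t ∈ Icc 0 T) (hs : s ∈ Icc (0 : ℝ) 1)
    (h : ∀ s ∈ Icc (0 : ℝ) 1, dtIter T k f t s = 0) : dtIter T k (ds f) t s = 0 := by
  rw [← hf.ds_dtIter hT k t ht s hs, ds, derivWithin_congr h (h s hs)]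
  simp

/-- Along curves in a set `K`, `fderivWithin` is compatible with negation, even where `K` does not
have unique derivatives. -/
lemma fderivWithin_fun_neg_apply {B : Type*} [NormedAddCommGroup B] [NormedSpace ℝ B]
    {K : Set B} {φ : B → ℝ} {c : ℝ → B} {c' : B} {I : Set ℝ} (hI : UniqueDiffWithinAt ℝ I s)
    (hφ : DifferentiableWithinAt ℝ φ K (c s)) (hc : HasDerivWithinAt c c' I s)
    (hm : MapsTo c I K) :
    fderivWithin ℝ (fun w => -φ w) K (c s) c' = -fderivWithin ℝ φ K (c s) c' := by
  have h1 := hφ.hasFDerivWithinAt.comp_hasDerivWithinAt s hc hm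
  have h2 := hφ.fun_neg.hasFDerivWithinAt.comp_hasDerivWithinAt s hc hm
  rw [← h2.derivWithin hI, ← h1.neg.derivWithin hI]
  rfl

end Boundary

/-! ### The boundary term and its derivative -/

namespace DefiningTriple

variable {N M : ℕ} {P : DefiningTriple N M} {u : ℝ → ℝ → Fin M → ℝ}
  {σ : ℝ → Jet (HatIdx N P.r) (2 * P.hatr - 1)} {F : ℝ → ℝ → HatIdx N P.r → ℝ} {t s : ℝ}

/-- The variation field `∂F^j/∂s`. -/
def varField {N r : ℕ} (F : ℝ → ℝ → HatIdx N r → ℝ) (j : HatIdx N r) : ℝ → ℝ → ℝ :=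
  ds fun t s => F t s j

/-- The boundary term `∑_β p^i_β(L) ∂_s q^i_(β)`. -/
def momentumTerm (P : DefiningTriple N M) (u : ℝ → ℝ → Fin M → ℝ)
    (F : ℝ → ℝ → HatIdx N P.r → ℝ) (i : Fin N) (t s : ℝ) : ℝ :=
  ∑ m ∈ Finset.range P.r, altSum P.T P.r (partialFamily P.T P.L u (qFamily F) i) (m + 1) t s
    * dtIter P.T m (varField F (iq i)) t s

/-- The boundary term which is contributed by `h^i_β`, `h'^i_β`, `h''^i_β`. -/
def auxTerm (P : DefiningTriple N M) (F : ℝ → ℝ → HatIdx N P.r → ℝ) (i : Fin N) (β : Fin P.r)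
    (t s : ℝ) : ℝ :=
  dtIter P.T 1 (fun t s => F t s (ih i β)) t s * varField F (ih i β) t s
    - dtIter P.T 2 (fun t s => F t s (ih1 i β)) t s * dtIter P.T 1 (varField F (ih1 i β)) t s
    - dtIter P.T 2 (fun t s => F t s (ih2 i β)) t s * dtIter P.T 1 (varField F (ih2 i β)) t s

/-- The total boundary term. -/
def boundaryTerm (P : DefiningTriple N M) (u : ℝ → ℝ → Fin M → ℝ)
    (F : ℝ → ℝ → HatIdx N P.r → ℝ) (t s : ℝ) : ℝ :=
  ∑ i, (momentumTerm P u F i t s + ∑ β, auxTerm P F i β t s)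

lemma SmoothOnRect.hasDerivWithinAt_dtIter {T : ℝ} {f : ℝ → ℝ → ℝ} (hT : 0 < T)
    (hf : SmoothOnRect T f) (k : ℕ) (ht : t ∈ Icc 0 T) (hs : s ∈ Icc (0 : ℝ) 1) :
    HasDerivWithinAt (fun τ => dtIter T k f τ s) (dtIter T (k + 1) f t s) (Icc 0 T) t := by
  rw [dtIter_succ]
  exact (hf.dtIter hT k).hasDerivWithinAt_dt hT ht hs

namespace IsHatVariation

lemma smooth_varField (hF : P.IsHatVariation u σ F) (j : HatIdx N P.r) :
    SmoothOnRect P.T (varField F j) :=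
  (hF.smooth_apply j).ds P.T_pos

lemma smooth_momentumTerm (hF : P.IsHatVariation u σ F) (i : Fin N) :
    SmoothOnRect P.T (momentumTerm P u F i) :=
  SmoothOnRect.sum _ fun m _ => (smoothOnRect_altSum P.T_pos (hF.smooth_partialL i) _).mul
    ((hF.smooth_varField _).dtIter P.T_pos m)

lemma smooth_auxTerm (hF : P.IsHatVariation u σ F) (i : Fin N) (β : Fin P.r) :
    SmoothOnRect P.T (auxTerm P F i β) :=
  ((((hF.smooth_apply _).dtIter P.T_pos 1).mul (hF.smooth_varField _)).sub
    (((hF.smooth_apply _).dtIter P.T_pos 2).mul ((hF.smooth_varField _).dtIter P.T_pos 1))).sub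
    (((hF.smooth_apply _).dtIter P.T_pos 2).mul ((hF.smooth_varField _).dtIter P.T_pos 1))

lemma smooth_boundaryTerm (hF : P.IsHatVariation u σ F) :
    SmoothOnRect P.T (boundaryTerm P u F) :=
  SmoothOnRect.sum _ fun i _ => (hF.smooth_momentumTerm i).add
    (SmoothOnRect.sum _ fun β _ => hF.smooth_auxTerm i β)

lemma smooth_correction (hF : P.IsHatVariation u σ F) (i : Fin N) (β : Fin P.r) :
    SmoothOnRect P.T (P.correction F i β) :=
  (((hF.smooth_apply (ih1 i β)).dtIter P.T_pos 3).mul (hF.smooth_varField _)).add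
    (((hF.smooth_apply (ih2 i β)).dtIter P.T_pos 3).mul (hF.smooth_varField _))

/-- The derivative of the boundary term contributed by the auxiliary variables. -/
lemma dt_auxTerm (hF : P.IsHatVariation u σ F) (ht : t ∈ Icc 0 P.T) (hs : s ∈ Icc (0 : ℝ) 1)
    (i : Fin N) (β : Fin P.r) :
    dt P.T (auxTerm P F i β) t s
      = (F t s (ih i β) * varField F (ih i β) t s
          + dtIter P.T 1 (fun t s => F t s (ih i β)) t s * dtIter P.T 1 (varField F (ih i β)) t s)
        - (dtIter P.T 3 (fun t s => F t s (ih1 i β)) t s * dtIter P.T 1 (varField F (ih1 i β)) t s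
          + dtIter P.T 2 (fun t s => F t s (ih1 i β)) t s * dtIter P.T 2 (varField F (ih1 i β)) t s)
        - (dtIter P.T 3 (fun t s => F t s (ih2 i β)) t s * dtIter P.T 1 (varField F (ih2 i β)) t s
          + dtIter P.T 2 (fun t s => F t s (ih2 i β)) t s
            * dtIter P.T 2 (varField F (ih2 i β)) t s) := by
  have hf := fun j k => SmoothOnRect.hasDerivWithinAt_dtIter P.T_pos (hF.smooth_apply j) k ht hs
  have hv := fun j k => SmoothOnRect.hasDerivWithinAt_dtIter P.T_pos (hF.smooth_varField j) k ht hs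
  have hv0 := hv (ih i β) 0
  simp only [dtIter_zero] at hv0
  -- The product rule produces `h_(2)` where the statement has `h`.
  rw [← hF.h_eq ht hs]
  exact (((hf (ih i β) 1).fun_mul hv0).fun_sub ((hf (ih1 i β) 2).fun_mul (hv (ih1 i β) 1))
    |>.fun_sub ((hf (ih2 i β) 2).fun_mul (hv (ih2 i β) 1))).derivWithin
    (uniqueDiffOn_Icc P.T_pos t ht)

lemma dt_correction (hF : P.IsHatVariation u σ F) (ht : t ∈ Icc 0 P.T) (hs : s ∈ Icc (0 : ℝ) 1)
    (i : Fin N) (β : Fin P.r) :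
    dt P.T (P.correction F i β) t s
      = (P.kappa * F t s (ih1 i β) * varField F (ih1 i β) t s
          + dtIter P.T 3 (fun t s => F t s (ih1 i β)) t s * dtIter P.T 1 (varField F (ih1 i β)) t s)
        + (P.kappa * F t s (ih2 i β) * varField F (ih2 i β) t s
          + dtIter P.T 3 (fun t s => F t s (ih2 i β)) t s
            * dtIter P.T 1 (varField F (ih2 i β)) t s) := by
  have hf := fun j k => SmoothOnRect.hasDerivWithinAt_dtIter P.T_pos (hF.smooth_apply j) k ht hs
  have hv := fun j => SmoothOnRect.hasDerivWithinAt_dtIter P.T_pos (hF.smooth_varField j) 0 ht hs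
  simp only [dtIter_zero] at hv
  rw [← hF.h1_eq ht hs, ← hF.h2_eq ht hs]
  exact (((hf (ih1 i β) 3).fun_mul (hv (ih1 i β))).fun_add
    ((hf (ih2 i β) 3).fun_mul (hv (ih2 i β)))).derivWithin (uniqueDiffOn_Icc P.T_pos t ht)

/-- The products of a third derivative of `h'` or `h''` with the first `t`-derivative of its
variation cancel. What remains is the `s`-derivative of the quadratic part of `tildeL`, so
`correction` is the part of its primitive not contained in `auxTerm`. -/
lemma dt_auxTerm_add_dt_correction (hF : P.IsHatVariation u σ F) (ht : t ∈ Icc 0 P.T)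
    (hs : s ∈ Icc (0 : ℝ) 1) (i : Fin N) (β : Fin P.r) :
    dt P.T (auxTerm P F i β) t s + dt P.T (P.correction F i β) t s
      = (dtIter P.T 1 (fun t s => F t s (ih i β)) t s * dtIter P.T 1 (varField F (ih i β)) t s
          - dtIter P.T 2 (fun t s => F t s (ih1 i β)) t s * dtIter P.T 2 (varField F (ih1 i β)) t s
          - dtIter P.T 2 (fun t s => F t s (ih2 i β)) t s * dtIter P.T 2 (varField F (ih2 i β)) t s)
        + (F t s (ih i β) * varField F (ih i β) t s
          + P.kappa * (F t s (ih1 i β) * varField F (ih1 i β) t s)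
          + P.kappa * (F t s (ih2 i β) * varField F (ih2 i β) t s)) := by
  rw [hF.dt_auxTerm ht hs, hF.dt_correction ht hs]
  ring

lemma dt_boundaryTerm (hF : P.IsHatVariation u σ F) (ht : t ∈ Icc 0 P.T)
    (hs : s ∈ Icc (0 : ℝ) 1) :
    dt P.T (boundaryTerm P u F) t s
      = ∑ i, (dt P.T (momentumTerm P u F i) t s + ∑ β, dt P.T (auxTerm P F i β) t s) :=
  (HasDerivWithinAt.fun_sum fun i _ =>
    ((hF.smooth_momentumTerm i).hasDerivWithinAt_dt P.T_pos ht hs).fun_add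
      (HasDerivWithinAt.fun_sum fun β _ =>
        (hF.smooth_auxTerm i β).hasDerivWithinAt_dt P.T_pos ht hs)).derivWithin
    (uniqueDiffOn_Icc P.T_pos t ht)

lemma mixedDeriv_correction (hF : P.IsHatVariation u σ F) (ht : t ∈ Icc 0 P.T)
    (hs : s ∈ Icc (0 : ℝ) 1) (i : Fin N) (β : Fin P.r) :
    P.mixedDeriv (fun t' s' => ∫ v in (0 : ℝ)..s', P.correction F i β t' v) t s
      = dt P.T (P.correction F i β) t s :=
  dt_congr ht hs fun _ ht' _ hs' =>
    derivWithin_integral_Icc ((hF.smooth_correction i β).slice_snd ht').continuousOn hs'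

/-- Expands `∂u/∂s` in the standard basis, so that the control term of `ds_lagrangian` becomes the
sum in the formula, with the sign of `𝒫 = -L`. -/
lemma sum_Yu_mul (hF : P.IsHatVariation u σ F) (ht : t ∈ Icc 0 P.T) (hs : s ∈ Icc (0 : ℝ) 1) :
    ∑ a : Fin M, Yu u a t s * P.pontryaginPartial t (jet P.T P.n (fun τ => F τ s) t) a (u t s)
      = - fderivWithin ℝ (fun w => P.L t (jetFamily P.T P.n (qFamily F) t s) w) P.K (u t s)
          (ds u t s) := by
  have h1 : ds u t s = ∑ a : Fin M, Yu u a t s • (Pi.single a 1 : Fin M → ℝ) := by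
    funext b
    rw [ds_pi_apply hF.smooth_u b ht hs, Finset.sum_apply, Finset.sum_eq_single b]
    · simp [Yu, ds]
    · intro a _ hab; simp [hab.symm]
    · simp
  have h2 : P.pontryagin t (jet P.T P.n (fun τ => F τ s) t)
      = fun w => -P.L t (jetFamily P.T P.n (qFamily F) t s) w := by
    funext w
    rw [pontryagin, ← hF.qJet_jetFamily ht hs]
    rfl
  have h3 : DifferentiableWithinAt ℝ
      (fun w => P.L t (jetFamily P.T P.n (qFamily F) t s) w) P.K (u t s) := by
    have hx := jetFamily_zero_mem (n := P.n) hF.q_mem_Q ht hs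
    have hc : DifferentiableWithinAt ℝ
        (fun w : Fin M → ℝ => (t, jetFamily P.T P.n (qFamily F) t s, w)) P.K (u t s) := by fun_prop
    exact DifferentiableWithinAt.comp
      (g := fun z : ℝ × Jet (Fin N) P.n × (Fin M → ℝ) => P.L z.1 z.2.1 z.2.2) (u t s)
      (P.L_smooth.differentiableOn (by simp) _ ⟨hx, hF.u_mem_K t ht s hs⟩) hc
      fun w hw => ⟨hx, hw⟩
  rw [← fderivWithin_fun_neg_apply (uniqueDiffOn_Icc one_pos s hs) h3
    (hF.smooth_u.hasDerivWithinAt_ds ht hs) (hF.u_mem_K t ht)]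
  simp only [pontryaginPartial, h2]
  conv_rhs => rw [h1, map_sum]
  simp

/-- The derivative of the modified Lagrangian with respect to the variation parameter. -/
lemma ds_tildeL (hF : P.IsHatVariation u σ F) (ht : t ∈ Icc 0 P.T) (hs : s ∈ Icc (0 : ℝ) 1) :
    HasDerivWithinAt (fun v => P.tildeL t (jetFamily P.T P.n F t v) (u t v))
      (ds (fun t s => P.L t (jetFamily P.T P.n (qFamily F) t s) (u t s)) t s
        + ∑ i : Fin N, ∑ β : Fin P.r,
          (dtIter P.T 1 (fun t s => F t s (ih i β)) t s * dtIter P.T 1 (varField F (ih i β)) t s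
          - dtIter P.T 2 (fun t s => F t s (ih1 i β)) t s * dtIter P.T 2 (varField F (ih1 i β)) t s
          - dtIter P.T 2 (fun t s => F t s (ih2 i β)) t s * dtIter P.T 2 (varField F (ih2 i β)) t s)
        + ∑ i : Fin N, ∑ β : Fin P.r,
          (F t s (ih i β) * varField F (ih i β) t s
          + P.kappa * (F t s (ih1 i β) * varField F (ih1 i β) t s)
          + P.kappa * (F t s (ih2 i β) * varField F (ih2 i β) t s))) (Icc 0 1) s := by
  have hn := P.three_le_n
  have hL : SmoothOnRect P.T fun t s => P.L t (jetFamily P.T P.n (qFamily F) t s) (u t s) :=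
    smoothOnRect_comp_lagrangian P.T_pos P.L_smooth hF.smooth_q hF.smooth_u hF.q_mem_Q hF.u_mem_K
  have hc : ∀ j k, HasDerivWithinAt (fun v => dtIter P.T k (fun t s => F t s j) t v ^ 2)
      (2 * (dtIter P.T k (fun t s => F t s j) t s * dtIter P.T k (varField F j) t s))
      (Icc 0 1) s := fun j k => by
    have h := ((hF.smooth_apply j).dtIter P.T_pos k).hasDerivWithinAt_ds ht hs
    rw [(hF.smooth_apply j).ds_dtIter P.T_pos k t ht s hs] at h
    simpa [mul_assoc, varField] using h.fun_pow 2
  have h3 := HasDerivWithinAt.const_mul (1 / 2 : ℝ) (HasDerivWithinAt.fun_sum (u := Finset.univ)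
    fun (i : Fin N) _ => HasDerivWithinAt.fun_sum (u := Finset.univ) fun (β : Fin P.r) _ =>
      ((hc (ih i β) 1).fun_sub (hc (ih1 i β) 2)).fun_sub (hc (ih2 i β) 2))
  have h4 := HasDerivWithinAt.const_mul (1 / 2 : ℝ) (HasDerivWithinAt.fun_sum (u := Finset.univ)
    fun (i : Fin N) _ => HasDerivWithinAt.fun_sum (u := Finset.univ) fun (β : Fin P.r) _ =>
      ((hc (ih i β) 0).fun_add ((hc (ih1 i β) 0).const_mul P.kappa)).fun_add
        ((hc (ih2 i β) 0).const_mul P.kappa))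
  have h5 := ((hL.hasDerivWithinAt_ds ht hs).fun_add h3).fun_add h4
  have hval : ∀ v ∈ Icc (0 : ℝ) 1, P.tildeL t (jetFamily P.T P.n F t v) (u t v) = _ :=
    fun v hv => by
      unfold tildeL
      simp only [hF.qJet_jetFamily ht hv, hF.jet_coord_eq ht hv (show 1 ≤ P.n by omega),
        hF.jet_coord_eq ht hv (show 2 ≤ P.n by omega), hF.jet_coord_eq ht hv (Nat.zero_le P.n)]
      rfl
  refine (h5.congr hval (hval s hs)).congr_deriv ?_
  simp only [Finset.mul_sum, dtIter_zero]
  congr 1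
  · congr 1
    exact Finset.sum_congr rfl fun i _ => Finset.sum_congr rfl fun β _ => by ring
  · exact Finset.sum_congr rfl fun i _ => Finset.sum_congr rfl fun β _ => by ring

/-- The integrand of the homotopy formula is the `t`-derivative of the boundary term. -/
lemma integrand_eq (hF : P.IsHatVariation u σ F) (ht : t ∈ Icc 0 P.T)
    (hs : s ∈ Icc (0 : ℝ) 1) :
    (∑ a : Fin M, Yu u a t s * P.pontryaginPartial t (jet P.T P.n (fun τ => F τ s) t) a (u t s))
        - P.mixedDeriv (fun t' s' => F t' s' imu) t s
        - ∑ β : Fin P.r, ∑ i : Fin N,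
            P.mixedDeriv (fun t' s' => ∫ v in (0 : ℝ)..s', P.correction F i β t' v) t s
      = dt P.T (boundaryTerm P u F) t s := by
  have hmu : HasDerivWithinAt (fun v => dtIter P.T 1 (fun t s => F t s imu) t v)
      (P.mixedDeriv (fun t' s' => F t' s' imu) t s) (Icc 0 1) s := by
    have h := ((hF.smooth_apply imu).dtIter P.T_pos 1).hasDerivWithinAt_ds ht hs
    rw [(hF.smooth_apply imu).ds_dtIter P.T_pos 1 t ht s hs, dtIter_succ 0 (ds _), dtIter_zero] at h
    exact h
  -- The identity `μ_(1) + tildeL = 0` is differentiated in `s`.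
  have hsum := (hmu.fun_add (hF.ds_tildeL ht hs)).derivWithin (uniqueDiffOn_Icc one_pos s hs)
  rw [derivWithin_congr (f := fun _ => (0 : ℝ)) (fun v hv => hF.mu_add_tildeL ht hv)
    (hF.mu_add_tildeL ht hs), derivWithin_fun_const] at hsum
  have hL := ds_lagrangian P.T_pos P.isOpen_Q (show P.r ≤ P.n by have := P.order_le; omega)
    P.L_smooth P.L_order hF.smooth_q hF.smooth_u hF.q_mem_Q hF.u_mem_K ht hs
  -- On solutions, only the control term and the `t`-derivative of the momentum terms remain.
  simp only [hF.eulerLagrange_L ht hs, zero_mul, zero_add] at hL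
  rw [hL] at hsum
  rw [hF.sum_Yu_mul ht hs, hF.dt_boundaryTerm ht hs, Finset.sum_comm]
  simp only [hF.mixedDeriv_correction ht hs]
  change (0 : ℝ) = _ + (_ + ∑ i, dt P.T (momentumTerm P u F i) t s + _ + _) at hsum
  have haux := Finset.sum_congr (s₁ := Finset.univ) rfl fun (i : Fin N) _ =>
    Finset.sum_congr (s₁ := Finset.univ) rfl fun (β : Fin P.r) _ =>
      hF.dt_auxTerm_add_dt_correction ht hs i β
  simp only [Finset.sum_add_distrib] at haux hsum ⊢
  linarith

/-! ### End values of the boundary term -/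

/-- At `t = 0`, `∂_s h_β = ∂_s q_(β)` and `h_β(1) = -p_β`, so the `h`-term cancels the momentum
term; the other two vanish since the velocities of `h'` and `h''` are zero for every `s`. -/
lemma boundaryTerm_zero (hF : P.IsHatVariation u σ F) (hs : s ∈ Icc (0 : ℝ) 1) :
    boundaryTerm P u F 0 s = 0 := by
  have ht : (0 : ℝ) ∈ Icc 0 P.T := left_mem_Icc.2 P.T_pos.le
  refine Finset.sum_eq_zero fun i _ => ?_
  rw [momentumTerm, Finset.sum_range, ← Finset.sum_add_distrib]
  refine Finset.sum_eq_zero fun β _ => ?_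
  have h0 : dtIter P.T 0 (varField F (ih i β)) 0 s = dtIter P.T β (varField F (iq i)) 0 s :=
    dtIter_ds_eq_of_eq P.T_pos (hF.smooth_apply _) (hF.smooth_apply _) ht hs
      fun s hs => (hF.controlled s hs).h_zero i β
  have h1 : dtIter P.T 1 (varField F (ih1 i β)) 0 s = 0 :=
    dtIter_ds_eq_zero_of_eq P.T_pos (hF.smooth_apply _) ht hs
      fun s hs => (hF.controlled s hs).h1_zero_deriv i β
  have h2 : dtIter P.T 1 (varField F (ih2 i β)) 0 s = 0 :=
    dtIter_ds_eq_zero_of_eq P.T_pos (hF.smooth_apply _) ht hs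
      fun s hs => (hF.controlled s hs).h2_zero_deriv i β
  have h3 : dtIter P.T 1 (fun t s => F t s (ih i β)) 0 s
      = -altSum P.T P.r (partialFamily P.T P.L u (qFamily F) i) (β + 1) 0 s :=
    ((hF.controlled s hs).h_zero_deriv i β).trans (congrArg _ (momentum_L i β))
  rw [auxTerm, h1, h2, h3, ← h0, dtIter_zero]
  ring

/-- Chain rule at `t = T`; only orders `β < r` contribute because `C` has actual order at most `r -
1`. -/
lemma ds_terminalCost (hF : P.IsHatVariation u σ F) (hs : s ∈ Icc (0 : ℝ) 1) :
    derivWithin (fun v => P.terminalCost fun t => F t v) (Icc 0 1) s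
      = ∑ i, ∑ β : Fin P.r, costPartialFamily P.T P.C (qFamily F) i β P.T s
          * dtIter P.T β (varField F (iq i)) P.T s := by
  have ht : P.T ∈ Icc 0 P.T := right_mem_Icc.2 P.T_pos.le
  have hr : P.r ≤ P.n + 1 := by have := P.order_le; omega
  have hval : ∀ v ∈ Icc (0 : ℝ) 1, P.terminalCost (fun t => F t v)
      = P.C P.T (jetFamily P.T P.n (qFamily F) P.T v) := fun v hv =>
    congrArg (P.C P.T) (hF.qJet_jetFamily ht hv)
  have h0 := jetFamily_zero_mem (n := P.n) hF.q_mem_Q ht hs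
  have hd := (hasFDerivAt_cost P.isOpen_Q P.C_smooth P.T h0).differentiableAt.hasFDerivAt
  have hj := (smoothOnRect_jetFamily (n := P.n) P.T_pos hF.smooth_q).hasDerivWithinAt_ds ht hs
  have hcomp : HasDerivWithinAt (fun v => P.C P.T (jetFamily P.T P.n (qFamily F) P.T v)) _
      (Icc 0 1) s := hd.comp_hasDerivWithinAt s hj
  rw [derivWithin_congr hval (hval s hs), hcomp.derivWithin (uniqueDiffOn_Icc one_pos s hs),
    ContinuousLinearMap.apply_jet, Finset.sum_comm]
  refine Finset.sum_congr rfl fun i _ => ?_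
  rw [← Finset.sum_range (fun β => costPartialFamily P.T P.C (qFamily F) i β P.T s
    * dtIter P.T β (varField F (iq i)) P.T s)]
  symm
  refine (Finset.sum_congr rfl fun k hk => ?_).trans
    (Finset.sum_subset (Finset.range_mono hr) fun k _ hk => ?_)
  · have hk' : k ≤ P.n := by have := Finset.mem_range.1 hk; omega
    rw [ds_jetFamily_coord P.T_pos hF.smooth_q hk' i ht hs, smul_eq_mul, mul_comm]
    rfl
  · rw [show fderiv ℝ (P.C P.T) (jetFamily P.T P.n (qFamily F) P.T s) (coordVec P.n k i) = 0
      from hF.partialC_eq_zero i (by simpa using hk) P.T ht s hs, smul_zero]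

/-- At `t = T` the `h''`-term cancels the `h`-term, and the `h'`-term is `-(p_β + ∂C/∂q_(β)) ∂_s
q_(β)`, which cancels the momentum term and leaves the variation of `-C`. -/
lemma boundaryTerm_T (hF : P.IsHatVariation u σ F) (hs : s ∈ Icc (0 : ℝ) 1) :
    boundaryTerm P u F P.T s
      = -derivWithin (fun v => P.terminalCost fun t => F t v) (Icc 0 1) s := by
  have ht : P.T ∈ Icc 0 P.T := right_mem_Icc.2 P.T_pos.le
  rw [hF.ds_terminalCost hs, ← Finset.sum_neg_distrib]
  refine Finset.sum_congr rfl fun i _ => ?_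
  rw [momentumTerm, Finset.sum_range, ← Finset.sum_add_distrib, ← Finset.sum_neg_distrib]
  refine Finset.sum_congr rfl fun β _ => ?_
  have h1 : dtIter P.T 1 (varField F (ih1 i β)) P.T s = dtIter P.T β (varField F (iq i)) P.T s :=
    dtIter_ds_eq_of_eq P.T_pos (hF.smooth_apply _) (hF.smooth_apply _) ht hs
      fun s hs => (hF.controlled s hs).h1_T_deriv i β
  have h2 : dtIter P.T 1 (varField F (ih2 i β)) P.T s = dtIter P.T 0 (varField F (ih i β)) P.T s :=
    dtIter_ds_eq_of_eq P.T_pos (hF.smooth_apply _) (hF.smooth_apply _) ht hs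
      fun s hs => (hF.controlled s hs).h2_T_deriv i β
  have h3 : dtIter P.T 2 (fun t s => F t s (ih1 i β)) P.T s
      = altSum P.T P.r (partialFamily P.T P.L u (qFamily F) i) (β + 1) P.T s
        + costPartialFamily P.T P.C (qFamily F) i β P.T s :=
    ((hF.controlled s hs).h1_T_deriv2 i β).trans (hF.momentum_LdC ht hs i β.2.le)
  have h4 : dtIter P.T 2 (fun t s => F t s (ih2 i β)) P.T s
      = dtIter P.T 1 (fun t s => F t s (ih i β)) P.T s := (hF.controlled s hs).h2_T_deriv2 i β
  rw [auxTerm, h1, h2, h3, h4, dtIter_zero]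
  ring

lemma smooth_terminalCost (hF : P.IsHatVariation u σ F) :
    ContDiffOn ℝ ∞ (fun v => P.terminalCost fun t => F t v) (Icc 0 1) := by
  have ht : P.T ∈ Icc 0 P.T := right_mem_Icc.2 P.T_pos.le
  exact ((smoothOnRect_comp_cost P.T_pos P.C_smooth hF.smooth_q hF.q_mem_Q).slice_snd ht).congr
    fun v hv => congrArg (P.C P.T) (hF.qJet_jetFamily ht hv)

end IsHatVariation

end DefiningTriple

end

end ELMayer

theorem theorem6p1 {N M : ℕ} (P : ELMayer.DefiningTriple N M)
    (u : ℝ → ℝ → Fin M → ℝ)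
    (σ : ℝ → ELMayer.Jet (ELMayer.HatIdx N P.r) (2 * P.hatr - 1))
    (F : ℝ → ℝ → ELMayer.HatIdx N P.r → ℝ)
    (hF : P.IsHatVariation u σ F) :
    P.terminalCost (fun t => F t 1) - P.terminalCost (fun t => F t 0) =
      - ∫ t in (0 : ℝ)..P.T, ∫ s in (0 : ℝ)..1,
          ((∑ a : Fin M, ELMayer.DefiningTriple.Yu u a t s *
              P.pontryaginPartial t (ELMayer.jet P.T P.n (fun τ => F τ s) t) a (u t s))
            - P.mixedDeriv (fun t' s' => F t' s' ELMayer.imu) t s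
            - ∑ β : Fin P.r, ∑ i : Fin N,
                P.mixedDeriv (fun t' s' => ∫ v in (0 : ℝ)..s', P.correction F i β t' v) t s) := by
  rw [intervalIntegral.integral_congr (g := fun t => ∫ s in (0 : ℝ)..1,
      ELMayer.dt P.T (P.boundaryTerm u F) t s) fun t ht =>
    intervalIntegral.integral_congr fun s hs => hF.integrand_eq
      (by rwa [uIcc_of_le P.T_pos.le] at ht) (by rwa [uIcc_of_le zero_le_one] at hs),
    hF.smooth_boundaryTerm.integral_integral_dt P.T_pos,
    intervalIntegral.integral_congr (g := fun s =>
      -derivWithin (fun v => P.terminalCost fun t => F t v) (Icc 0 1) s) fun s hs => by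
        rw [uIcc_of_le zero_le_one] at hs
        simp only [hF.boundaryTerm_T hs, hF.boundaryTerm_zero hs, sub_zero],
    intervalIntegral.integral_neg, neg_neg,
    ELMayer.integral_derivWithin_Icc one_pos hF.smooth_terminalCost]
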